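/- Let $A\in\mathbb R^{n\times n}$, $C\in\mathbb R^{s\times n}$ with $(A,C)$ observable, and consider $$\dot x = Ax+u,\qquad y=G(t)Cx,\qquad G(t)=\mathrm{diag}(g_1(t),\dots,g_s(t)),\qquad t\ge 0 .$$ Suppose each $g_i$ is $C^{n-1}$ on $[0,\infty)$, bounded with bounded derivatives up to order $n-1$, and persistently exciting: there are $\alpha_1,\alpha_2,\delta>0$ with $\alpha_1\le\int_{t_0}^{t_0+\delta}g_i(\tau)^2\,d\tau\le\alpha_2$ for all $t_0\ge 0$. Call a nonsingular matrix $T$ a canonical transformation, with $p$ blocks of sizes $r_1,\dots,r_p\ge 1$ and with output $\pi(j)$ assigned to block $j$, if the following hold for $\hat A=TA^TT^{-1}$, $\hat B=TC^T$, whose (block) rows are indexed by the states $1,\dots,r_j$ of the blocks $j$. (i) The diagonal block $\hat A_{j,j}$ is the companion matrix with ones on the superdiagonal and last row $-\alpha_{j,r_j},\dots,-\alpha_{j,1}$. (ii) The block $\hat A_{k,j}$ in block row $k$ and block column $j$ is zero for $k>j$, and for $k<j$ only its first column may be nonzero. (iii) The column $\pi(j)$ of $\hat B$ is the unit vector of the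 last state of block $j$. (Up to a relabelling of the outputs, $\pi(j)=j$.) For block $j$, consider the nominal error dynamics $$\tfrac{d}{dt}{}^{j}\tilde z=\hat A_{j,j}^T\,{}^{j}\tilde z-{}^{j}\eta,\qquad \tilde y_j=g_{\pi(j)}(t)\,{}^{j}\tilde z_{r_j}.$$ An innovation ${}^j\eta=\ell_j(t)\tilde y_j$ with $\ell_j$ continuous on $[0,\infty)$ is called a design for this dynamics if it makes the origin exponentially stable, i.e. there are $m,\sigma>0$ with $\|{}^j\tilde z(t)\|\le m e^{-\sigma(t-t_0)}\|{}^j\tilde z(t_0)\|$ for all $t\ge t_0\ge 0$ and all solutions on $[t_0,\infty)$. Then a canonical transformation exists, and for every canonical transformation $T$: (a) (Persistence filter design.) Let $1\le j\le p$, write $g=g_{\pi(j)}$, $r=r_j$, let $k\ge\max\{2,r\}$ be even (for example $k=\max\{2,2^{\lceil\log_2 r\rceil}\}$), and let $\lambda>0$ satisfy $2v^T\hat A_{j,j}v<\lambda v^Tv$ for all $v\ne 0$. Let $R$ be a solution on $[0,\infty)$ of $\dot R=-\lambda R+g^k$ with $R(0)>0$, put $\phi=g^k/(2R)$, $D=d/dt$,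 and $P(X)=X^r+\alpha_{j,1}X^{r-1}+\dots+\alpha_{j,r}$. Let the functions $L_1,\dots,L_r$ be determined by the identity of differential operators $\sum_{m=1}^{r}D^{m-1}\circ L_m=P(D+\phi)-P(D)$. Then there is a bounded $\ell_j$ with $\ell_j(t)g(t)=(L_1(t),\dots,L_r(t))^T$ for all $t\ge0$ such that ${}^j\eta=\ell_j\tilde y_j$ is a design for the nominal dynamics of block $j$. (b) For every family of designs ${}^j\eta=\ell_j\tilde y_j$, $j=1,\dots,p$ (in particular for those of (a)), the observer $$\dot{\hat x}=A\hat x+u+T^T\eta,$$ where block $j$ of $\eta$ is ${}^j\eta=\ell_j(t)(y-\hat y)_{\pi(j)}$ with $\hat y=G(t)C\hat x$, makes the estimation error $\tilde x=x-\hat x$ converge to zero exponentially: there are $m,\sigma>0$ such that for every input $u$, every $t_0\ge 0$ and all solutions $x,\hat x$ on $[t_0,\infty)$, $\|\tilde x(t)\|\le m e^{-\sigma(t-t_0)}\|\tilde x(t_0)\|$ for all $t\ge t_0$. -/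

import Mathlib

open Matrix Set

/-- `(A, C)` is an observable pair: the Kalman observability matrix with block rows
`C, C A, …, C A^(n-1)` has trivial kernel, that is, full column rank `n`. -/
def IsObservablePair {n s : ℕ} (A : Matrix (Fin n) (Fin n) ℝ) (C : Matrix (Fin s) (Fin n) ℝ) :
    Prop :=
  ∀ v : Fin n → ℝ, (∀ q < n, C *ᵥ ((A ^ q) *ᵥ v) = 0) → v = 0

/-- Persistence of excitation of a scalar signal on `[0, ∞)`: the integral of its square over
windows of one fixed length lies between two positive constants, uniformly in the window. -/
def IsPE (g : ℝ → ℝ) : Prop :=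
  ∃ α₁ > 0, ∃ α₂ > 0, ∃ δ > 0, ∀ t₀ ≥ 0,
    α₁ ≤ ∫ τ in t₀..(t₀ + δ), g τ ^ 2 ∧ ∫ τ in t₀..(t₀ + δ), g τ ^ 2 ≤ α₂

/-- The function is `C^q` on `[0, ∞)` and bounded there with its derivatives up to order `q`. -/
def IsBoundedSmooth (q : ℕ) (g : ℝ → ℝ) : Prop :=
  ContDiffOn ℝ (q : WithTop ℕ∞) g (Ici 0) ∧
    ∀ l ≤ q, ∃ M : ℝ, ∀ t ≥ 0, |iteratedDerivWithin l g (Ici 0) t| ≤ M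

/-- `x` is a solution of `ẋ = f(t, x)` on `[t₀, ∞)` (with the one-sided derivative at `t₀`). -/
def SolvesFrom {ι : Type*} [Fintype ι] (f : ℝ → (ι → ℝ) → ι → ℝ) (t₀ : ℝ) (x : ℝ → ι → ℝ) : Prop :=
  ∀ t ≥ t₀, HasDerivWithinAt x (f t (x t)) (Ici t₀) t

/-- Exponential stability of the origin of `ẋ = F(t) x`, `t ≥ 0`, uniformly in the initial time.
(The norm is the sup norm; by equivalence of norms the choice only affects `m`.) -/
def IsExpStable {ι : Type*} [Fintype ι] (F : ℝ → Matrix ι ι ℝ) : Prop :=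
  ∃ m > 0, ∃ σ > 0, ∀ t₀ ≥ 0, ∀ x : ℝ → ι → ℝ, SolvesFrom (fun t v => F t *ᵥ v) t₀ x →
    ∀ t ≥ t₀, ‖x t‖ ≤ m * Real.exp (-σ * (t - t₀)) * ‖x t₀‖

/-- The companion matrix in controller form: ones on the superdiagonal, last row
`-a 0, …, -a (r-1)` (so `a i` is the coefficient of `X ^ i` in the characteristic polynomial,
`a i = α_{r-i}` in the numbering `-α_r, …, -α_1` of the last row). -/
def companion {r : ℕ} (a : Fin r → ℝ) : Matrix (Fin r) (Fin r) ℝ :=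
  Matrix.of fun (i j : Fin r) =>
    if (i : ℕ) + 1 = (j : ℕ) then 1 else if (i : ℕ) + 1 = r then -a j else 0

/-- `T`, with inverse `S`, transforms the pair `(Aᵀ, Cᵀ)` into the multi-input controller
canonical form with `p` blocks of sizes `r 0, …, r (p-1)`. The coordinate `⟨j, i⟩` is the `i`-th
state of block `j`. The matrix `T Aᵀ S` has diagonal blocks `companion (a j)`; its block in block
row `k`, block column `j` vanishes for `j < k`, and for `k < j` only its first column may be
nonzero. The column of `T Cᵀ` that belongs to the output `π j` of block `j` is the unit vector of
the last coordinate of block `j`; the remaining columns are arbitrary. -/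
structure IsCanonicalTransformation {n s p : ℕ} (A : Matrix (Fin n) (Fin n) ℝ)
    (C : Matrix (Fin s) (Fin n) ℝ) (r : Fin p → ℕ) (a : ∀ j, Fin (r j) → ℝ) (π : Fin p → Fin s)
    (T : Matrix (Σ j, Fin (r j)) (Fin n) ℝ) (S : Matrix (Fin n) (Σ j, Fin (r j)) ℝ) : Prop where
  pos : ∀ j, 0 < r j
  mul_inv : T * S = 1
  inv_mul : S * T = 1
  diag : ∀ j i i', (T * Aᵀ * S) ⟨j, i⟩ ⟨j, i'⟩ = companion (a j) i i'
  upper : ∀ k j, j < k → ∀ i i', (T * Aᵀ * S) ⟨k, i⟩ ⟨j, i'⟩ = 0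
  lower : ∀ k j, k < j → ∀ (i : Fin (r k)) (i' : Fin (r j)), (i' : ℕ) ≠ 0 → (T * Aᵀ * S) ⟨k, i⟩ ⟨j, i'⟩ = 0
  input : ∀ k (i : Fin (r k)) j, (T * Cᵀ) ⟨k, i⟩ (π j) = if k = j ∧ (i : ℕ) + 1 = r k then 1 else 0

/-- The matrix of the nominal single-output block error dynamics
`d/dt z̃ = Âᵀ z̃ - η`, `ỹ = g(t) z̃_r`, with the innovation `η = ℓ(t) ỹ`. -/
def nominalError {r : ℕ} (a : Fin r → ℝ) (g : ℝ → ℝ) (ℓ : ℝ → Fin r → ℝ) (t : ℝ) :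
    Matrix (Fin r) (Fin r) ℝ :=
  (companion a)ᵀ - vecMulVec (ℓ t) (fun j : Fin r => if (j : ℕ) + 1 = r then g t else 0)

/-- The innovation `η = ℓ(t) ỹ` solves the single-output observer problem for the nominal block:
its gain is continuous and it renders the nominal error dynamics exponentially stable. -/
structure IsInnovationGain {r : ℕ} (a : Fin r → ℝ) (g : ℝ → ℝ) (ℓ : ℝ → Fin r → ℝ) : Prop where
  cont : ContinuousOn ℓ (Ici 0)
  stable : IsExpStable (nominalError a g ℓ)

/-- `R` is a persistence filter state: `Ṙ = -lam R + g^k` on `[0, ∞)`, `R(0) > 0`. -/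
def IsPersistenceFilter (g : ℝ → ℝ) (k : ℕ) (lam : ℝ) (R : ℝ → ℝ) : Prop :=
  0 < R 0 ∧ ∀ t ≥ 0, HasDerivWithinAt R (-lam * R t + g t ^ k) (Ici 0) t

/-- The coefficients in `(D + φ)^i = ∑ m, D^m ∘ c i m` as operators on functions of time in
`[0, ∞)`, where `D` is the time derivative:
`c 0 0 = 1` and `c (i+1) m = c i (m-1) + φ * c i m - (c i m)'`. -/
noncomputable def shiftCoeff (φ : ℝ → ℝ) : ℕ → ℕ → ℝ → ℝ
  | 0, 0 => fun _ => 1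
  | 0, _ + 1 => fun _ => 0
  | i + 1, 0 => fun t =>
      φ t * shiftCoeff φ i 0 t - derivWithin (shiftCoeff φ i 0) (Ici 0) t
  | i + 1, m + 1 => fun t =>
      shiftCoeff φ i m t + φ t * shiftCoeff φ i (m + 1) t
        - derivWithin (shiftCoeff φ i (m + 1)) (Ici 0) t

/-- The gain `L` from the last state error `z̃_r` to the innovation in the persistence filter
design. With `φ = g^k / (2R)` and `P(X) = X^r + ∑ i < r, a i X^i`, it is determined by
`∑ m < r, D^m ∘ L m = P(D + φ) - P(D)`; so injecting `L z̃_r` replaces `P(D) z̃_r = 0` by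
`P(D + φ) z̃_r = 0`. -/
noncomputable def filterGain {r : ℕ} (a : Fin r → ℝ) (g : ℝ → ℝ) (k : ℕ) (R : ℝ → ℝ) (t : ℝ)
    (m : Fin r) : ℝ :=
  shiftCoeff (fun τ => g τ ^ k / (2 * R τ)) r m t
    + ∑ i : Fin r, a i * shiftCoeff (fun τ => g τ ^ k / (2 * R τ)) i m t - a m

/-- The measured output `G(t) C x` with `G(t) = diag(g 0 t, …, g (s-1) t)`. -/
def measuredOutput {n s : ℕ} (C : Matrix (Fin s) (Fin n) ℝ) (g : Fin s → ℝ → ℝ) (t : ℝ)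
    (x : Fin n → ℝ) : Fin s → ℝ :=
  (Matrix.diagonal fun i => g i t) *ᵥ (C *ᵥ x)

/-- The stacked innovation `η`: its block `j` is `ℓ j (t)` times the `π j`-th entry of `y - ŷ`. -/
def innovation {s p : ℕ} {r : Fin p → ℕ} (π : Fin p → Fin s) (ℓ : ∀ j, ℝ → Fin (r j) → ℝ) (t : ℝ)
    (y yhat : Fin s → ℝ) : (Σ j, Fin (r j)) → ℝ :=
  fun b => ℓ b.1 t b.2 * (y (π b.1) - yhat (π b.1))

/-! Observer. Put `z = Sᵀ *ᵥ (x - xhat)`. The error matrix in these coordinates is the transpose of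
the block triangular `T * Aᵀ * S`, and the entry `π j` of the output error is `g (π j)` times the
last state of block `j`. Hence block `j` follows its nominal dynamics, driven only by the blocks `k
< j` (`error_block`). A cascade of exponentially stable systems is exponentially stable
(`exists_cascade_bound`), each link being controlled by the forced response estimate
`IsExpStable.forced`.

Canonical form. The basis is built from chains generated by rows of `C` under `Aᵀ`, modulo the
invariant subspace already spanned (`exists_cyclic_block`). Observability supplies a fresh row as
long as that subspace is proper (`exists_row_notMem`).

Persistence filter. With `w = exp ∫ φ` one has `D + φ = w⁻¹ ∘ D ∘ w`, so `P(D + φ) y = 0` says that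
`w y` solves the equation of `P(D)`. Up to a bounded change of state with bounded inverse
(`pascalTransform`, with entries built from `appell`), the closed loop is therefore `v' = (Qᵀ - φ)
v` with `Q` the companion matrix. Since `2 R φ = g ^ k`, the derivative of `R |v|²` is `R (2 v·Qv -
lam |v|²)`: the term `g ^ k` of the filter cancels, and the choice of `lam` makes the rest negative.
Persistent excitation keeps `R` between positive constants (`exists_bounds`), so decay of the energy
is decay of `v`. The gain can be divided by `g` because each differentiation of `φ` destroys at most
one of its `k` factors `g`, and `r ≤ k` (`exists_appell_eq`). -/

/-! ### Global solutions of linear equations by the Picard series -/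

section LinearODE

variable {E : Type*} [NormedAddCommGroup E] [NormedSpace ℝ E]

/-- The terms of the Picard series of `ẋ = F(t) x`, `x(t₀) = x₀`. -/
noncomputable def picardTerm (F : ℝ → E →L[ℝ] E) (t₀ : ℝ) (x₀ : E) : ℕ → ℝ → E
  | 0 => fun _ => x₀
  | n + 1 => fun t => ∫ τ in t₀..t, F τ (picardTerm F t₀ x₀ n τ)

variable {F : ℝ → E →L[ℝ] E}

lemma continuous_picardTerm (hF : Continuous F) (t₀ : ℝ) (x₀ : E) (n : ℕ) :
    Continuous (picardTerm F t₀ x₀ n) := by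
  induction n with
  | zero => exact continuous_const
  | succ n ih =>
    exact intervalIntegral.continuous_primitive
      (fun a b => (hF.clm_apply ih).intervalIntegrable a b) t₀

lemma hasDerivAt_picardTerm_succ [CompleteSpace E] (hF : Continuous F) (t₀ : ℝ) (x₀ : E) (n : ℕ) (t : ℝ) :
    HasDerivAt (picardTerm F t₀ x₀ (n + 1)) (F t (picardTerm F t₀ x₀ n t)) t := by
  have hc := hF.clm_apply (continuous_picardTerm hF t₀ x₀ n)
  exact intervalIntegral.integral_hasDerivAt_right (hc.intervalIntegrable _ _)
    hc.aestronglyMeasurable.stronglyMeasurableAtFilter hc.continuousAt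

/-- Each integration of `|τ - t₀| ^ n` contributes a factor `1 / (n + 1)`; the resulting factorial
makes the series converge on every bounded interval. -/
lemma norm_picardTerm_le (t₀ : ℝ) (x₀ : E) {K N : ℝ}
    (hK : ∀ t, |t - t₀| ≤ N → ‖F t‖ ≤ K) (n : ℕ) {t : ℝ} (ht : |t - t₀| ≤ N) :
    ‖picardTerm F t₀ x₀ n t‖ ≤ ‖x₀‖ * (K ^ n * |t - t₀| ^ n / n.factorial) := by
  have hK0 : 0 ≤ K := (norm_nonneg _).trans (hK t ht)
  induction n generalizing t with
  | zero => simp [picardTerm]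
  | succ n ih =>
    have hsub : ∀ τ ∈ Set.uIoc t₀ t, |τ - t₀| ≤ |t - t₀| := fun τ hτ =>
      Set.abs_sub_left_of_mem_uIcc (Set.uIoc_subset_uIcc hτ)
    have h1 : ‖picardTerm F t₀ x₀ (n + 1) t‖ ≤
        |∫ τ in t₀..t, K * (‖x₀‖ * (K ^ n * |τ - t₀| ^ n / n.factorial))| := by
      refine intervalIntegral.norm_integral_le_abs_of_norm_le ?_ ?_
      · refine Filter.eventually_of_mem
          (MeasureTheory.self_mem_ae_restrict measurableSet_uIoc) fun τ hτ => ?_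
        have hτN := (hsub τ hτ).trans ht
        exact (ContinuousLinearMap.le_opNorm _ _).trans
          (mul_le_mul (hK τ hτN) (ih hτN) (norm_nonneg _) hK0)
      · exact Continuous.intervalIntegrable (by fun_prop) _ _
    have h2 : |∫ τ in t₀..t, K * (‖x₀‖ * (K ^ n * |τ - t₀| ^ n / n.factorial))| =
        ‖x₀‖ * (K ^ (n + 1) * |t - t₀| ^ (n + 1) / (n + 1).factorial) := by
      have h3 : ∀ τ, K * (‖x₀‖ * (K ^ n * |τ - t₀| ^ n / n.factorial)) =
          (‖x₀‖ * K ^ (n + 1) / n.factorial) * |τ - t₀| ^ n := fun τ => by ring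
      simp only [h3]
      rw [intervalIntegral.integral_const_mul, abs_mul, intervalIntegral.abs_intervalIntegral_eq,
        integral_pow_abs_sub_uIoc, abs_of_nonneg (by positivity), abs_of_nonneg (by positivity),
        Nat.factorial_succ]
      push_cast
      have := Nat.factorial_ne_zero n
      field_simp
    exact h1.trans h2.le

/-- Global existence for linear differential equations with continuous coefficients. -/
theorem exists_hasDerivAt_linear [CompleteSpace E] (hF : Continuous F) (t₀ : ℝ) (x₀ : E) :
    ∃ x : ℝ → E, x t₀ = x₀ ∧ ∀ t, HasDerivAt x (F t (x t)) t := by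
  refine ⟨fun t => ∑' n, picardTerm F t₀ x₀ n t, ?_, fun t => ?_⟩
  · have h0 : ∀ n, n ≠ 0 → picardTerm F t₀ x₀ n t₀ = 0 := by
      rintro (_ | n) hn
      · exact absurd rfl hn
      · simp [picardTerm]
    simp only []
    rw [tsum_eq_single 0 h0]
    rfl
  -- The added `1` places `t` inside an open ball, on which the series can be differentiated term by
  -- term.
  set N := |t - t₀| + 1 with hN
  obtain ⟨K, hK⟩ : ∃ K, ∀ τ, |τ - t₀| ≤ N → ‖F τ‖ ≤ K := by
    obtain ⟨K, hK⟩ := (isCompact_closedBall t₀ N).exists_bound_of_continuousOn hF.continuousOn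
    exact ⟨K, fun τ hτ => hK τ (by simpa [Real.dist_eq] using hτ)⟩
  have hK0 : 0 ≤ K := (norm_nonneg _).trans (hK t (by linarith))
  have hN0 : 0 ≤ N := by positivity
  have hterm : ∀ n τ, |τ - t₀| ≤ N →
      ‖picardTerm F t₀ x₀ n τ‖ ≤ ‖x₀‖ * ((K * N) ^ n / n.factorial) := fun n τ hτ => by
    refine (norm_picardTerm_le t₀ x₀ hK n hτ).trans ?_
    rw [mul_pow]
    gcongr
  have hsum : Summable fun n : ℕ => ‖x₀‖ * ((K * N) ^ n / n.factorial) :=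
    (Real.summable_pow_div_factorial _).mul_left _
  let g' : ℕ → ℝ → E := fun n => match n with
    | 0 => fun _ => 0
    | n + 1 => fun τ => F τ (picardTerm F t₀ x₀ n τ)
  let u : ℕ → ℝ := fun n => match n with
    | 0 => 0
    | n + 1 => K * (‖x₀‖ * ((K * N) ^ n / n.factorial))
  have hu : Summable u := (summable_nat_add_iff 1).1 (hsum.mul_left K)
  have hball : ∀ τ, τ ∈ Metric.ball t₀ N → |τ - t₀| ≤ N := fun τ hτ => by
    rw [Metric.mem_ball, Real.dist_eq] at hτ
    exact hτ.le
  have htmem : t ∈ Metric.ball t₀ N := by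
    rw [Metric.mem_ball, Real.dist_eq]; linarith
  have hsumt : Summable fun n => picardTerm F t₀ x₀ n t :=
    Summable.of_norm_bounded hsum fun n => hterm n t (hball t htmem)
  have key := hasDerivAt_tsum_of_isPreconnected (g := picardTerm F t₀ x₀) (g' := g') hu
    Metric.isOpen_ball (convex_ball t₀ N).isPreconnected
    (fun n τ _ => by
      cases n with
      | zero => exact hasDerivAt_const τ x₀
      | succ n => exact hasDerivAt_picardTerm_succ hF t₀ x₀ n τ)
    (fun n τ hτ => by
      cases n with
      | zero => simp [g', u]
      | succ n =>
        refine (ContinuousLinearMap.le_opNorm _ _).trans ?_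
        exact mul_le_mul (hK τ (hball τ hτ)) (hterm n τ (hball τ hτ)) (norm_nonneg _) hK0)
    htmem hsumt htmem
  have hg' : ∑' n, g' n t = F t (∑' n, picardTerm F t₀ x₀ n t) := by
    have hs : Summable fun n => g' n t := (summable_nat_add_iff 1).1
      ((F t).summable hsumt)
    rw [hs.tsum_eq_zero_add, (F t).map_tsum hsumt]
    simp [g']
  rwa [hg'] at key

end LinearODE

/-! ### Forced response of exponentially stable systems -/

section Stability

variable {ι : Type*} [Fintype ι] {F : ℝ → Matrix ι ι ℝ}

lemma exists_hasDerivAt_mulVec (hF : Continuous F) (t₀ : ℝ) (x₀ : ι → ℝ) :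
    ∃ x : ℝ → ι → ℝ, x t₀ = x₀ ∧ ∀ t, HasDerivAt x (F t *ᵥ x t) t := by
  classical
  let Λ : Matrix ι ι ℝ →ₗ[ℝ] ((ι → ℝ) →L[ℝ] (ι → ℝ)) :=
    (LinearMap.toContinuousLinearMap (𝕜 := ℝ) (E := ι → ℝ) (F' := ι → ℝ)).toLinearMap ∘ₗ
      (Matrix.toLin' (R := ℝ) (m := ι) (n := ι)).toLinearMap
  have hΛ : Continuous Λ := LinearMap.continuous_of_finiteDimensional Λ
  simpa [Λ] using exists_hasDerivAt_linear (hΛ.comp hF) t₀ x₀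

/-- Coefficients are only known on `[0, ∞)`. Freezing them at their value at `0` for negative times
makes the global existence theorem applicable. -/
lemma ContinuousOn.continuous_comp_max {X : Type*} [TopologicalSpace X] {f : ℝ → X}
    (hf : ContinuousOn f (Ici 0)) : Continuous fun t => f (max t 0) :=
  hf.comp_continuous (by fun_prop) fun t => le_max_right t 0

/-- Response of an exponentially stable system to an exponentially decaying input. -/
theorem IsExpStable.forced (hF : ContinuousOn F (Ici 0)) (h : IsExpStable F) :
    ∃ m > 0, ∃ σ > 0, ∀ t₀ ≥ 0, ∀ x f : ℝ → ι → ℝ,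
      (∀ t ≥ t₀, HasDerivWithinAt x (F t *ᵥ x t + f t) (Ici t₀) t) →
      ∀ N ρ : ℝ, (∀ t ≥ t₀, ‖f t‖ ≤ N * Real.exp (-ρ * (t - t₀))) →
      ∀ t ≥ t₀, ‖x t‖ ≤ m * Real.exp (-σ * (t - t₀)) * ‖x t₀‖ +
        m * N * (t - t₀) * Real.exp (-min σ ρ * (t - t₀)) := by
  classical
  obtain ⟨m, hm, σ, hσ, hst⟩ := h
  -- Any constant at least `m` serves here.
  refine ⟨Fintype.card ι * m + 1, by positivity, σ, hσ, fun t₀ ht₀ x f hx N ρ hf T hT => ?_⟩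
  have hN : 0 ≤ N := by
    have := (norm_nonneg _).trans (hf t₀ le_rfl)
    simpa using this
  set c : ℝ := Fintype.card ι * m + 1 with hc
  have hc0 : 0 < c := by positivity
  have hTt : 0 ≤ T - t₀ := sub_nonneg.2 hT
  refine (pi_norm_le_iff_of_nonneg (by positivity)).2 fun i => ?_
  have hFc : Continuous fun t => F (max t 0) := hF.continuous_comp_max
  -- The adjoint solution ending at the `i`-th unit vector at time `T` replaces the variation of
  -- constants formula: `p ⬝ᵥ x` equals `x T i` at time `T`, and its derivative contains only the
  -- input.
  obtain ⟨p, hpT, hp⟩ := exists_hasDerivAt_mulVec (F := fun t => -(F (max t 0))ᵀ)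
    hFc.matrix_transpose.neg T (Pi.single i 1)
  -- the derivative of `p ⬝ᵥ y` along solutions with input
  have hdot : ∀ s ≥ 0, ∀ y w : ℝ → ι → ℝ,
      (∀ t ≥ s, HasDerivWithinAt y (F t *ᵥ y t + w t) (Ici s) t) → ∀ t ≥ s,
      HasDerivWithinAt (fun t => p t ⬝ᵥ y t) (p t ⬝ᵥ w t) (Ici s) t := by
    intro s hs y w hy t ht
    have h1 : HasDerivWithinAt (fun t => ∑ k, p t k * y t k)
        (∑ k, ((-(F (max t 0))ᵀ *ᵥ p t) k * y t k + p t k * (F t *ᵥ y t + w t) k)) (Ici s) t :=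
      HasDerivWithinAt.fun_sum fun k _ =>
        ((hasDerivAt_pi.1 (hp t) k).hasDerivWithinAt).mul (hasDerivWithinAt_pi.1 (hy t ht) k)
    refine h1.congr_deriv ?_
    rw [max_eq_left (hs.le.trans ht)]
    have h2 : (-(F t)ᵀ *ᵥ p t) ⬝ᵥ y t + p t ⬝ᵥ (F t *ᵥ y t + w t) = p t ⬝ᵥ w t := by
      rw [neg_mulVec, neg_dotProduct, dotProduct_add, mulVec_transpose, dotProduct_mulVec]
      ring
    rw [← h2, Finset.sum_add_distrib]
    rfl
  -- The adjoint inherits the decay by duality: `p ⬝ᵥ y` is constant along the unforced solution `y`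
  -- starting from `v` at time `s`, so `p s ⬝ᵥ v = y T i`.
  have hpb : ∀ s ≥ 0, s ≤ T → ∀ v : ι → ℝ,
      |p s ⬝ᵥ v| ≤ m * Real.exp (-σ * (T - s)) * ‖v‖ := by
    intro s hs hsT v
    obtain ⟨y, hys, hy⟩ := exists_hasDerivAt_mulVec hFc s v
    have hy' : ∀ t ≥ s, HasDerivWithinAt y (F t *ᵥ y t + 0) (Ici s) t := fun t ht => by
      have := (hy t).hasDerivWithinAt (s := Ici s)
      rwa [max_eq_left (hs.le.trans ht), ← add_zero (F t *ᵥ y t)] at this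
    have hconst := norm_image_sub_le_of_norm_deriv_le_segment' (a := s) (b := T) (C := 0)
      (fun t ht => (hdot s hs y 0 hy' t ht.1).mono Icc_subset_Ici_self)
      (fun t _ => by simp) T ⟨hsT, le_rfl⟩
    have hEq : p T ⬝ᵥ y T = p s ⬝ᵥ y s := by
      rw [zero_mul, norm_le_zero_iff, sub_eq_zero] at hconst
      exact hconst
    rw [← hys, ← hEq, hpT, single_one_dotProduct]
    exact (norm_le_pi_norm (y T) i).trans
      (hst s hs y (fun t ht => by simpa using hy' t ht) T hsT)
  have hmv := norm_image_sub_le_of_norm_deriv_le_segment' (a := t₀) (b := T)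
    (C := m * N * Real.exp (-min σ ρ * (T - t₀)))
    (fun t ht => (hdot t₀ ht₀ x f hx t ht.1).mono Icc_subset_Ici_self)
    (fun t ht => by
      refine (hpb t (ht₀.le.trans ht.1) ht.2.le (f t)).trans ?_
      have h1 := hf t ht.1
      calc m * Real.exp (-σ * (T - t)) * ‖f t‖
          ≤ m * Real.exp (-σ * (T - t)) * (N * Real.exp (-ρ * (t - t₀))) := by gcongr
        _ = m * N * Real.exp (-σ * (T - t) + -ρ * (t - t₀)) := by rw [Real.exp_add]; ring
        _ ≤ m * N * Real.exp (-min σ ρ * (T - t₀)) := by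
          have h3 : min σ ρ * (T - t) ≤ σ * (T - t) :=
            mul_le_mul_of_nonneg_right (min_le_left _ _) (sub_nonneg.2 ht.2.le)
          have h4 : min σ ρ * (t - t₀) ≤ ρ * (t - t₀) :=
            mul_le_mul_of_nonneg_right (min_le_right _ _) (sub_nonneg.2 ht.1)
          gcongr
          linarith) T ⟨hT, le_rfl⟩
  have h0 := hpb t₀ ht₀ hT (x t₀)
  rw [hpT, single_one_dotProduct] at hmv
  have hcard : m ≤ c := by
    have : (1 : ℝ) ≤ Fintype.card ι := by
      exact_mod_cast Fintype.card_pos_iff.2 ⟨i⟩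
    nlinarith
  calc ‖x T i‖ ≤ ‖p t₀ ⬝ᵥ x t₀‖ + ‖x T i - p t₀ ⬝ᵥ x t₀‖ := by
        simpa using norm_add_le (p t₀ ⬝ᵥ x t₀) (x T i - p t₀ ⬝ᵥ x t₀)
    _ ≤ m * Real.exp (-σ * (T - t₀)) * ‖x t₀‖
        + m * N * Real.exp (-min σ ρ * (T - t₀)) * (T - t₀) := add_le_add h0 hmv
    _ = m * Real.exp (-σ * (T - t₀)) * ‖x t₀‖
        + m * N * (T - t₀) * Real.exp (-min σ ρ * (T - t₀)) := by ring
    _ ≤ _ := by gcongr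

end Stability

/-! ### Cascades of exponentially stable systems -/

lemma Matrix.exists_norm_mulVec_le {ι κ : Type*} [Fintype ι] [Fintype κ] (B : Matrix ι κ ℝ) :
    ∃ b ≥ 0, ∀ v : κ → ℝ, ‖B *ᵥ v‖ ≤ b * ‖v‖ := by
  classical
  exact ⟨_, norm_nonneg _, fun v => (LinearMap.toContinuousLinearMap (toLin' B)).le_opNorm v⟩

/-- Half of the decay rate is spent on absorbing the linear factor that resonance between a block
and its input can produce. -/
lemma mul_exp_neg_le {μ τ : ℝ} (hμ : 0 < μ) :
    τ * Real.exp (-μ * τ) ≤ 2 / μ * Real.exp (-(μ / 2) * τ) := by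
  have h1 : μ / 2 * τ ≤ Real.exp (μ / 2 * τ) := by
    linarith [Real.add_one_le_exp (μ / 2 * τ)]
  have h2 : τ ≤ 2 / μ * Real.exp (μ / 2 * τ) := by
    calc τ = 2 / μ * (μ / 2 * τ) := by field_simp
      _ ≤ _ := by gcongr
  calc τ * Real.exp (-μ * τ) ≤ 2 / μ * Real.exp (μ / 2 * τ) * Real.exp (-μ * τ) := by gcongr
    _ = 2 / μ * Real.exp (-(μ / 2) * τ) := by
      rw [mul_assoc, ← Real.exp_add]; ring_nf

/-- A cascade of exponentially stable linear systems is exponentially stable. -/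
theorem exists_cascade_bound {p : ℕ} {κ : Fin p → Type*} [∀ j, Fintype (κ j)]
    {F : ∀ j, ℝ → Matrix (κ j) (κ j) ℝ} (hF : ∀ j, ContinuousOn (F j) (Ici 0))
    (hst : ∀ j, IsExpStable (F j)) (B : ∀ j k, Matrix (κ j) (κ k) ℝ) :
    ∃ m > 0, ∃ σ > 0, ∀ t₀ ≥ 0, ∀ z : ∀ j, ℝ → κ j → ℝ,
      (∀ j, ∀ t ≥ t₀, HasDerivWithinAt (z j)
        (F j t *ᵥ z j t + ∑ k with k < j, B j k *ᵥ z k t) (Ici t₀) t) →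
      ∀ Z : ℝ, (∀ j, ‖z j t₀‖ ≤ Z) → ∀ j, ∀ t ≥ t₀,
        ‖z j t‖ ≤ m * Real.exp (-σ * (t - t₀)) * Z := by
  suffices h : ∀ q : ℕ, ∃ m > 0, ∃ σ > 0, ∀ t₀ ≥ 0, ∀ z : ∀ j, ℝ → κ j → ℝ,
      (∀ j, ∀ t ≥ t₀, HasDerivWithinAt (z j)
        (F j t *ᵥ z j t + ∑ k with k < j, B j k *ᵥ z k t) (Ici t₀) t) →
      ∀ Z : ℝ, (∀ j, ‖z j t₀‖ ≤ Z) → ∀ j : Fin p, (j : ℕ) < q → ∀ t ≥ t₀,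
        ‖z j t‖ ≤ m * Real.exp (-σ * (t - t₀)) * Z by
    obtain ⟨m, hm, σ, hσ, h⟩ := h p
    exact ⟨m, hm, σ, hσ, fun t₀ ht₀ z hz Z hZ j => h t₀ ht₀ z hz Z hZ j j.2⟩
  intro q
  induction q with
  | zero => exact ⟨1, one_pos, 1, one_pos, fun _ _ _ _ _ _ _ h => absurd h (Nat.not_lt_zero _)⟩
  | succ q ih =>
    obtain ⟨m, hm, σ, hσ, ih⟩ := ih
    by_cases hq : q < p
    swap
    · exact ⟨m, hm, σ, hσ, fun t₀ ht₀ z hz Z hZ j _ =>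
        ih t₀ ht₀ z hz Z hZ j (j.2.trans_le (not_lt.1 hq))⟩
    obtain ⟨m', hm', σ', hσ', hf⟩ := IsExpStable.forced (hF ⟨q, hq⟩) (hst ⟨q, hq⟩)
    choose b hb0 hb using fun k => (B ⟨q, hq⟩ k).exists_norm_mulVec_le
    set μ := min σ' σ with hμ
    have hμ0 : 0 < μ := lt_min hσ' hσ
    set c := ∑ k with k < (⟨q, hq⟩ : Fin p), b k with hc
    have hc0 : 0 ≤ c := Finset.sum_nonneg fun k _ => hb0 k
    -- The three summands cover the earlier blocks, the initial value of block `q`, and its forcing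
    -- by the earlier blocks. The last uses `mul_exp_neg_le`, whence the halved rate.
    refine ⟨m + m' + m' * (c * m) * (2 / μ), by positivity, μ / 2, by positivity,
      fun t₀ ht₀ z hz Z hZ j hj t ht => ?_⟩
    have hZ0 : 0 ≤ Z := (norm_nonneg _).trans (hZ j)
    have ht' : 0 ≤ t - t₀ := sub_nonneg.2 ht
    have hexp : ∀ ν, μ ≤ ν → Real.exp (-ν * (t - t₀)) ≤ Real.exp (-(μ / 2) * (t - t₀)) := by
      intro ν hν
      gcongr
      linarith
    have hpos : 0 ≤ Real.exp (-(μ / 2) * (t - t₀)) * Z := by positivity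
    rcases Nat.lt_succ_iff_lt_or_eq.1 hj with hj | hj
    · calc ‖z j t‖ ≤ m * Real.exp (-σ * (t - t₀)) * Z := ih t₀ ht₀ z hz Z hZ j hj t ht
        _ ≤ m * Real.exp (-(μ / 2) * (t - t₀)) * Z := by
          exact mul_le_mul_of_nonneg_right
            (mul_le_mul_of_nonneg_left (hexp σ (min_le_right _ _)) hm.le) hZ0
        _ ≤ (m + m' + m' * (c * m) * (2 / μ)) * (Real.exp (-(μ / 2) * (t - t₀)) * Z) := by
          rw [mul_assoc]
          refine mul_le_mul_of_nonneg_right ?_ hpos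
          have : 0 ≤ m' * (c * m) * (2 / μ) := by positivity
          linarith
        _ = _ := by ring
    · obtain rfl : j = ⟨q, hq⟩ := Fin.ext hj
      have h1 := hf t₀ ht₀ (z ⟨q, hq⟩) _ (hz ⟨q, hq⟩) (c * m * Z) σ (fun s hs => by
        refine (norm_sum_le _ _).trans ?_
        rw [hc, Finset.sum_mul, Finset.sum_mul, Finset.sum_mul]
        refine Finset.sum_le_sum fun k hk => (hb k _).trans ?_
        have h2 := ih t₀ ht₀ z hz Z hZ k (Finset.mem_filter.1 hk).2 s hs
        calc b k * ‖z k s‖ ≤ b k * (m * Real.exp (-σ * (s - t₀)) * Z) :=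
              mul_le_mul_of_nonneg_left h2 (hb0 k)
          _ = _ := by ring) t ht
      refine h1.trans ?_
      have h3 := mul_exp_neg_le (τ := t - t₀) hμ0
      have h4 : m' * Real.exp (-σ' * (t - t₀)) * ‖z ⟨q, hq⟩ t₀‖ ≤
          m' * (Real.exp (-(μ / 2) * (t - t₀)) * Z) := by
        have := hexp σ' (min_le_left _ _)
        rw [mul_assoc]
        exact mul_le_mul_of_nonneg_left
          (mul_le_mul this (hZ _) (norm_nonneg _) (Real.exp_nonneg _)) hm'.le
      have h5 : m' * (c * m * Z) * (t - t₀) * Real.exp (-μ * (t - t₀)) ≤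
          m' * (c * m) * (2 / μ) * (Real.exp (-(μ / 2) * (t - t₀)) * Z) := by
        calc m' * (c * m * Z) * (t - t₀) * Real.exp (-μ * (t - t₀))
            = m' * (c * m * Z) * ((t - t₀) * Real.exp (-μ * (t - t₀))) := by ring
          _ ≤ m' * (c * m * Z) * (2 / μ * Real.exp (-(μ / 2) * (t - t₀))) := by gcongr
          _ = _ := by ring
      have h6 : 0 ≤ m * (Real.exp (-(μ / 2) * (t - t₀)) * Z) := by positivity
      calc _ ≤ m' * (Real.exp (-(μ / 2) * (t - t₀)) * Z) +
            m' * (c * m) * (2 / μ) * (Real.exp (-(μ / 2) * (t - t₀)) * Z) := add_le_add h4 h5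
        _ ≤ _ := by linarith

lemma continuousOn_nominalError {r : ℕ} (a : Fin r → ℝ) {g : ℝ → ℝ} {ℓ : ℝ → Fin r → ℝ}
    (hg : ContinuousOn g (Ici 0)) (hℓ : ContinuousOn ℓ (Ici 0)) :
    ContinuousOn (nominalError a g ℓ) (Ici 0) := by
  unfold nominalError
  refine continuousOn_const.sub ?_
  refine continuousOn_pi.2 fun i => continuousOn_pi.2 fun j => ?_
  simp only [vecMulVec_apply]
  refine ((continuous_apply i).comp_continuousOn hℓ).mul ?_
  split_ifs
  · exact hg
  · exact continuousOn_const

/-! ### The observer error in canonical coordinates -/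

section Observer

variable {n s p : ℕ} {A : Matrix (Fin n) (Fin n) ℝ} {C : Matrix (Fin s) (Fin n) ℝ}
  {r : Fin p → ℕ} {a : ∀ j, Fin (r j) → ℝ} {π : Fin p → Fin s}
  {T : Matrix (Σ j, Fin (r j)) (Fin n) ℝ} {S : Matrix (Fin n) (Σ j, Fin (r j)) ℝ}

/-- The error dynamics in canonical coordinates: block `j` is the nominal error dynamics driven by
the preceding blocks. -/
lemma IsCanonicalTransformation.error_block (hT : IsCanonicalTransformation A C r a π T S)
    (g : Fin s → ℝ → ℝ) (ℓ : ∀ j, ℝ → Fin (r j) → ℝ) (t : ℝ) (x xhat v : Fin n → ℝ) (j : Fin p)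
    (i : Fin (r j)) :
    (Sᵀ *ᵥ (A *ᵥ x + v - (A *ᵥ xhat + v + Tᵀ *ᵥ innovation π ℓ t (measuredOutput C g t x)
      (measuredOutput C g t xhat)))) ⟨j, i⟩ =
    (nominalError (a j) (g (π j)) (ℓ j) t *ᵥ (fun i' => (Sᵀ *ᵥ (x - xhat)) ⟨j, i'⟩) +
      ∑ k with k < j, (Matrix.of fun (i : Fin (r j)) (i' : Fin (r k)) =>
        (T * Aᵀ * S) ⟨k, i'⟩ ⟨j, i⟩) *ᵥ (fun i' => (Sᵀ *ᵥ (x - xhat)) ⟨k, i'⟩)) i := by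
  set z := Sᵀ *ᵥ (x - xhat) with hz
  have hST : Sᵀ * Tᵀ = 1 := by rw [← transpose_mul, hT.mul_inv, transpose_one]
  have hTS : Tᵀ * Sᵀ = 1 := by rw [← transpose_mul, hT.inv_mul, transpose_one]
  have hx : x - xhat = Tᵀ *ᵥ z := by rw [hz, mulVec_mulVec, hTS, one_mulVec]
  have h1 : Sᵀ *ᵥ (A *ᵥ x + v - (A *ᵥ xhat + v + Tᵀ *ᵥ innovation π ℓ t (measuredOutput C g t x)
      (measuredOutput C g t xhat))) = (T * Aᵀ * S)ᵀ *ᵥ z - innovation π ℓ t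
        (measuredOutput C g t x) (measuredOutput C g t xhat) := by
    have : A *ᵥ x + v - (A *ᵥ xhat + v + Tᵀ *ᵥ innovation π ℓ t (measuredOutput C g t x)
      (measuredOutput C g t xhat)) = A *ᵥ (x - xhat) - Tᵀ *ᵥ innovation π ℓ t
        (measuredOutput C g t x) (measuredOutput C g t xhat) := by
      rw [mulVec_sub]; abel
    rw [this, mulVec_sub, mulVec_mulVec _ Sᵀ Tᵀ, hST, one_mulVec, hx, transpose_mul, transpose_mul,
      transpose_transpose, mulVec_mulVec, mulVec_mulVec, Matrix.mul_assoc]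
  have hlast : 0 < r j := hT.pos j
  -- Column `π j` of `T * Cᵀ` is a unit vector, so this output sees no other block.
  have h2 : (C *ᵥ (x - xhat)) (π j) = z ⟨j, ⟨r j - 1, by omega⟩⟩ := by
    have h3 : (C * Tᵀ) = (T * Cᵀ)ᵀ := by simp
    rw [hx, mulVec_mulVec, h3]
    simp only [mulVec, dotProduct, transpose_apply]
    rw [Finset.sum_eq_single ⟨j, ⟨r j - 1, by omega⟩⟩]
    · rw [hT.input, if_pos ⟨rfl, by simp; omega⟩, one_mul]
    · rintro ⟨k, i'⟩ - hne
      rw [hT.input, if_neg, zero_mul]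
      rintro ⟨rfl, hi⟩
      exact hne (by congr 1; ext; simp; omega)
    · simp
  have h4 : innovation π ℓ t (measuredOutput C g t x) (measuredOutput C g t xhat) ⟨j, i⟩ =
      ℓ j t i * (g (π j) t * z ⟨j, ⟨r j - 1, by omega⟩⟩) := by
    rw [← h2, mulVec_sub]
    simp only [innovation, measuredOutput, mulVec_diagonal, Pi.sub_apply]
    ring
  have h5 : (nominalError (a j) (g (π j)) (ℓ j) t *ᵥ fun i' => z ⟨j, i'⟩) i =
      ∑ i', (T * Aᵀ * S) ⟨j, i'⟩ ⟨j, i⟩ * z ⟨j, i'⟩ -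
        ℓ j t i * (g (π j) t * z ⟨j, ⟨r j - 1, by omega⟩⟩) := by
    rw [nominalError, sub_mulVec, vecMulVec_mulVec]
    simp only [Pi.sub_apply, Pi.smul_apply, MulOpposite.smul_eq_mul_unop, MulOpposite.unop_op]
    congr 1
    · simp only [mulVec, dotProduct, transpose_apply, hT.diag]
    · congr 1
      simp only [dotProduct]
      rw [Finset.sum_eq_single ⟨r j - 1, by omega⟩]
      · rw [if_pos (by simp; omega)]
      · intro i' _ hne
        rw [if_neg, zero_mul]
        intro hi
        exact hne (by ext; simp; omega)
      · simp
  rw [h1, Pi.sub_apply, h4, Pi.add_apply, h5, Finset.sum_apply]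
  have h6 : ((T * Aᵀ * S)ᵀ *ᵥ z) ⟨j, i⟩ =
      ∑ k, ∑ i' : Fin (r k), (T * Aᵀ * S) ⟨k, i'⟩ ⟨j, i⟩ * z ⟨k, i'⟩ := by
    simp only [mulVec, dotProduct, transpose_apply]
    rw [Fintype.sum_sigma]
  -- Transposition turns the vanishing of the blocks below the diagonal into the absence of any
  -- influence of later blocks on block `j`.
  have h7 : ∑ k with k ≤ j, ∑ i' : Fin (r k), (T * Aᵀ * S) ⟨k, i'⟩ ⟨j, i⟩ * z ⟨k, i'⟩ =
      ∑ k, ∑ i' : Fin (r k), (T * Aᵀ * S) ⟨k, i'⟩ ⟨j, i⟩ * z ⟨k, i'⟩ := by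
    refine Finset.sum_subset (Finset.subset_univ _) fun k _ hk => ?_
    have hk' : j < k := by simpa using hk
    exact Finset.sum_eq_zero fun i' _ => by rw [hT.upper k j hk', zero_mul]
  have h8 : (Finset.univ.filter fun k : Fin p => k ≤ j) =
      insert j (Finset.univ.filter fun k : Fin p => k < j) := by
    ext k; simp [le_iff_eq_or_lt]
  rw [h6, ← h7, h8, Finset.sum_insert (by simp)]
  simp only [mulVec, dotProduct, of_apply]
  ring

/-- The observer error converges exponentially for every family of nominal designs. -/
theorem IsCanonicalTransformation.observer_converges (hT : IsCanonicalTransformation A C r a π T S)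
    {g : Fin s → ℝ → ℝ} (hg : ∀ i, ContinuousOn (g i) (Ici 0)) {ℓ : ∀ j, ℝ → Fin (r j) → ℝ}
    (hℓ : ∀ j, IsInnovationGain (a j) (g (π j)) (ℓ j)) :
    ∃ m > 0, ∃ σ > 0, ∀ (u : ℝ → Fin n → ℝ), ∀ t₀ ≥ 0, ∀ x xhat : ℝ → Fin n → ℝ,
      SolvesFrom (fun t v => A *ᵥ v + u t) t₀ x →
      SolvesFrom (fun t v => A *ᵥ v + u t
        + Tᵀ *ᵥ innovation π ℓ t (measuredOutput C g t (x t)) (measuredOutput C g t v)) t₀ xhat →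
      ∀ t ≥ t₀, ‖x t - xhat t‖ ≤ m * Real.exp (-σ * (t - t₀)) * ‖x t₀ - xhat t₀‖ := by
  obtain ⟨m, hm, σ, hσ, h⟩ := exists_cascade_bound
    (fun j => continuousOn_nominalError (a j) (hg (π j)) (hℓ j).cont) (fun j => (hℓ j).stable)
    (fun j k => Matrix.of fun (i : Fin (r j)) (i' : Fin (r k)) => (T * Aᵀ * S) ⟨k, i'⟩ ⟨j, i⟩)
  obtain ⟨bT, hbT0, hbT⟩ := Tᵀ.exists_norm_mulVec_le
  obtain ⟨bS, hbS0, hbS⟩ := Sᵀ.exists_norm_mulVec_le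
  have hTS : Tᵀ * Sᵀ = 1 := by rw [← transpose_mul, hT.inv_mul, transpose_one]
  refine ⟨bT * m * bS + 1, by positivity, σ, hσ, fun u t₀ ht₀ x xhat hx hxhat t ht => ?_⟩
  let z : ∀ j, ℝ → Fin (r j) → ℝ := fun j t i => (Sᵀ *ᵥ (x t - xhat t)) ⟨j, i⟩
  have hz : ∀ j t, ‖z j t‖ ≤ ‖Sᵀ *ᵥ (x t - xhat t)‖ := fun j t =>
    (pi_norm_le_iff_of_nonneg (norm_nonneg _)).2 fun i => norm_le_pi_norm (Sᵀ *ᵥ (x t - xhat t)) ⟨j, i⟩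
  have hder : ∀ j, ∀ t ≥ t₀, HasDerivWithinAt (z j) (nominalError (a j) (g (π j)) (ℓ j) t *ᵥ z j t +
      ∑ k with k < j, (Matrix.of fun (i : Fin (r j)) (i' : Fin (r k)) =>
        (T * Aᵀ * S) ⟨k, i'⟩ ⟨j, i⟩) *ᵥ z k t) (Ici t₀) t := by
    intro j t ht
    refine hasDerivWithinAt_pi.2 fun i => ?_
    have h1 := (hx t ht).sub (hxhat t ht)
    rw [← hT.error_block g ℓ t (x t) (xhat t) (u t) j i]
    exact HasDerivWithinAt.fun_sum (u := Finset.univ) fun k _ =>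
      (hasDerivWithinAt_pi.1 h1 k).const_mul (Sᵀ ⟨j, i⟩ k)
  have hb := h t₀ ht₀ z hder ‖Sᵀ *ᵥ (x t₀ - xhat t₀)‖ (fun j => hz j t₀)
  have h3 : ‖Sᵀ *ᵥ (x t - xhat t)‖ ≤
      m * Real.exp (-σ * (t - t₀)) * ‖Sᵀ *ᵥ (x t₀ - xhat t₀)‖ :=
    (pi_norm_le_iff_of_nonneg (by positivity)).2 fun ⟨j, i⟩ =>
      (norm_le_pi_norm (z j t) i).trans (hb j t ht)
  calc ‖x t - xhat t‖ = ‖Tᵀ *ᵥ (Sᵀ *ᵥ (x t - xhat t))‖ := by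
        rw [mulVec_mulVec, hTS, one_mulVec]
    _ ≤ bT * ‖Sᵀ *ᵥ (x t - xhat t)‖ := hbT _
    _ ≤ bT * (m * Real.exp (-σ * (t - t₀)) * (bS * ‖x t₀ - xhat t₀‖)) := by
        gcongr
        exact h3.trans (by gcongr; exact hbS _)
    _ = bT * m * bS * (Real.exp (-σ * (t - t₀)) * ‖x t₀ - xhat t₀‖) := by ring
    _ ≤ (bT * m * bS + 1) * (Real.exp (-σ * (t - t₀)) * ‖x t₀ - xhat t₀‖) := by
        gcongr
        linarith
    _ = _ := by ring

end Observer

/-! ### Construction of the canonical form -/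

section CyclicBlock

variable {E : Type*} [AddCommGroup E] [Module ℝ E] [FiniteDimensional ℝ E]

lemma Submodule.finrank_sup_span_singleton_of_notMem {V : Submodule ℝ E} {b : E} (hb : b ∉ V) :
    Module.finrank ℝ (V ⊔ Submodule.span ℝ {b} : Submodule ℝ E) = Module.finrank ℝ V + 1 := by
  have hb0 : b ≠ 0 := fun h => hb (h ▸ V.zero_mem)
  have hd : Disjoint V (Submodule.span ℝ {b}) := (Submodule.disjoint_span_singleton' hb0).2 hb
  rw [← finrank_span_singleton (K := ℝ) hb0, ← Submodule.finrank_sup_add_finrank_inf_eq,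
    hd.eq_bot, finrank_bot, add_zero]

/-- Adjoining to an invariant subspace `V` the cyclic subspace generated by `b ∉ V`: a basis `s`
of the new part in which the operator acts modulo `V` by a companion matrix. -/
lemma exists_cyclic_block (f : E →ₗ[ℝ] E) {V : Submodule ℝ E} {b : E} (hb : b ∉ V) :
    ∃ (r : ℕ) (a : Fin r → ℝ) (s : Fin r → E), 0 < r ∧ (∀ i : Fin r, (i : ℕ) + 1 = r → s i = b) ∧
      (∀ i i' : Fin r, (i : ℕ) + 1 = i' → f (s i') = s i - a i' • b) ∧
      (∀ i : Fin r, (i : ℕ) = 0 → f (s i) + a i • b ∈ V) ∧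
      Module.finrank ℝ (V ⊔ Submodule.span ℝ (range s) : Submodule ℝ E) =
        Module.finrank ℝ V + r := by
  classical
  let w : ℕ → E := fun q => (f ^ q) b
  have hw : ∀ q, f (w q) = w (q + 1) := fun q => by
    simp only [w, pow_succ']; rfl
  let W : ℕ → Submodule ℝ E := fun q => V ⊔ Submodule.span ℝ (range fun i : Fin q => w i)
  have hWsucc : ∀ q, W (q + 1) = W q ⊔ Submodule.span ℝ {w q} := by
    intro q
    have : (range fun i : Fin (q + 1) => w i) = (range fun i : Fin q => w i) ∪ {w q} := by
      ext x
      constructor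
      · rintro ⟨i, rfl⟩
        rcases Nat.lt_succ_iff_lt_or_eq.1 i.2 with hi | hi
        · exact Or.inl ⟨⟨i, hi⟩, rfl⟩
        · exact Or.inr (congrArg w hi)
      · rintro (⟨i, rfl⟩ | rfl)
        · exact ⟨i.castSucc, rfl⟩
        · exact ⟨Fin.last q, rfl⟩
    simp only [W, this, Submodule.span_union, sup_assoc]
  have hfin : ∀ q, (∀ i < q, w i ∉ W i) → Module.finrank ℝ (W q) = Module.finrank ℝ V + q := by
    intro q hq
    induction q with
    | zero =>
      have : W 0 = V := by simp [W, range_eq_empty]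
      rw [this, add_zero]
    | succ q ih =>
      rw [hWsucc, Submodule.finrank_sup_span_singleton_of_notMem (hq q q.lt_succ_self),
        ih fun i hi => hq i (hi.trans q.lt_succ_self), add_assoc]
  have hex : ∃ q, w q ∈ W q := by
    by_contra! h
    have h1 := hfin (Module.finrank ℝ E + 1) fun i _ => h i
    have h2 := (W (Module.finrank ℝ E + 1)).finrank_le
    omega
  -- The first power that is dependent modulo `V` on the earlier ones. Minimality makes each earlier
  -- power raise the dimension by one; `b ∉ V` excludes `r = 0`.
  set r := Nat.find hex with hr
  have hr1 : w r ∈ W r := Nat.find_spec hex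
  have hr2 : ∀ i < r, w i ∉ W i := fun i hi => Nat.find_min hex hi
  have hr0 : 0 < r := by
    rw [Nat.pos_iff_ne_zero]
    intro h0
    rw [h0] at hr1
    exact hb (by simpa [W, w] using hr1)
  obtain ⟨v, hv, y, hy, hvy⟩ := Submodule.mem_sup.1 hr1
  obtain ⟨c, hc⟩ := (Submodule.mem_span_range_iff_exists_fun ℝ).1 hy
  let a : ℕ → ℝ := fun i => if h : i < r then -c ⟨i, h⟩ else 0
  -- The Horner partial sums of `P(f) b`, where `P` is the monic relation just found: `σ 0 = b`, `σ
  -- (q + 1) = f (σ q) + a (r - 1 - q) • b`, and `σ r = P(f) b` lies in `V`. Listed in reverse order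
  -- they form the companion chain, ending in `b`.
  let σ : ℕ → E := fun q => w q + ∑ i ∈ Finset.range q, a (r - q + i) • w i
  have hσ0 : σ 0 = b := by simp [σ, w]
  have hσs : ∀ q, q < r → f (σ q) = σ (q + 1) - a (r - 1 - q) • b := by
    intro q hq
    simp only [σ, map_add, map_sum, map_smul, hw, Finset.sum_range_succ']
    have h1 : ∀ i, r - (q + 1) + (i + 1) = r - q + i := fun i => by omega
    have h2 : r - (q + 1) + 0 = r - 1 - q := by omega
    simp only [h1, h2]
    simp [w]
    abel
  have hσr : σ r = v := by
    have h1 : ∑ i ∈ Finset.range r, a (r - r + i) • w i = -y := by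
      rw [Finset.sum_range, ← hc, ← Finset.sum_neg_distrib]
      refine Finset.sum_congr rfl fun i _ => ?_
      simp [a]
    simp only [σ, h1, ← hvy]
    abel
  let s : Fin r → E := fun i => σ (r - 1 - i)
  have hspan : V ⊔ Submodule.span ℝ (range s) = W r := by
    apply le_antisymm
    · refine sup_le le_sup_left (Submodule.span_le.2 ?_)
      rintro _ ⟨i, rfl⟩
      have hmem : ∀ q < r, w q ∈ W r := fun q hq =>
        Submodule.mem_sup_right (Submodule.subset_span ⟨⟨q, hq⟩, rfl⟩)
      have := i.2
      refine (W r).add_mem (hmem _ (by omega)) ((W r).sum_mem fun l hl => ?_)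
      have := Finset.mem_range.1 hl
      exact (W r).smul_mem _ (hmem _ (by omega))
    · refine sup_le le_sup_left (Submodule.span_le.2 ?_)
      have hmem : ∀ q < r, w q ∈ V ⊔ Submodule.span ℝ (range s) := by
        intro q
        induction q using Nat.strong_induction_on with
        | _ q ih =>
          intro hq
          have h1 : w q = σ q - ∑ i ∈ Finset.range q, a (r - q + i) • w i := by simp [σ]
          rw [h1]
          refine Submodule.sub_mem _ (Submodule.mem_sup_right (Submodule.subset_span
            ⟨⟨r - 1 - q, by omega⟩, ?_⟩)) (Submodule.sum_mem _ fun l hl => ?_)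
          · simp only [s]
            congr 1
            omega
          · have := Finset.mem_range.1 hl
            exact Submodule.smul_mem _ _ (ih l this (by omega))
      rintro _ ⟨i, rfl⟩
      exact hmem i i.2
  refine ⟨r, fun i => a i, s, hr0, ?_, ?_, ?_, ?_⟩
  · intro i hi
    have : r - 1 - (i : ℕ) = 0 := by omega
    simp only [s, this, hσ0]
  · intro i i' hii
    have := i'.2
    have h1 : r - 1 - (i : ℕ) = r - 1 - (i' : ℕ) + 1 := by omega
    have h2 : r - 1 - (r - 1 - (i' : ℕ)) = i' := by omega
    simp only [s, h1, hσs (r - 1 - i') (by omega), h2]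
  · intro i hi
    have h1 : r - 1 - (r - 1 - (i : ℕ)) = i := by omega
    have h2 : r - 1 - (i : ℕ) + 1 = r := by omega
    simp only [s, hσs (r - 1 - i) (by omega), h1, h2, sub_add_cancel, hσr]
    exact hv
  · rw [hspan, hfin r hr2]

end CyclicBlock

/-- For an observable pair, a proper `Aᵀ`-invariant subspace misses some column of `Cᵀ`. -/
lemma IsObservablePair.exists_row_notMem {n s : ℕ} {A : Matrix (Fin n) (Fin n) ℝ}
    {C : Matrix (Fin s) (Fin n) ℝ} (h : IsObservablePair A C) {V : Submodule ℝ (Fin n → ℝ)}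
    (hV : ∀ v ∈ V, Aᵀ *ᵥ v ∈ V) (hne : V ≠ ⊤) : ∃ c, C c ∉ V := by
  by_contra! hC
  -- A nonzero functional vanishing on `V`, read as a vector `w`, kills every `(Aᵀ ^ q) *ᵥ C c`;
  -- this says `C *ᵥ ((A ^ q) *ᵥ w) = 0`, so observability forces `w = 0`.
  obtain ⟨φ, hφ, hker⟩ := Submodule.exists_le_ker_of_lt_top V (lt_top_iff_ne_top.2 hne)
  let w : Fin n → ℝ := fun i => φ (Pi.single i 1)
  have hw : ∀ x, φ x = w ⬝ᵥ x := fun x => by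
    rw [LinearMap.pi_apply_eq_sum_univ φ x]
    simp only [dotProduct, w, smul_eq_mul, mul_comm]
    refine Finset.sum_congr rfl fun i _ => ?_
    congr 2
    ext j
    simp [Pi.single_apply, eq_comm]
  have hpow : ∀ (q : ℕ) c, (Aᵀ ^ q) *ᵥ C c ∈ V := by
    intro q c
    induction q with
    | zero => simpa using hC c
    | succ q ih => rw [pow_succ', ← mulVec_mulVec]; exact hV _ ih
  have hw0 : w = 0 := h w fun q _ => by
    ext c
    have h1 := hker (hpow q c)
    rw [LinearMap.mem_ker, hw, ← transpose_pow, mulVec_transpose, dotProduct_comm,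
      ← dotProduct_mulVec] at h1
    exact h1
  exact hφ (LinearMap.ext fun x => by rw [hw, hw0]; simp)

section Existence

variable {n s : ℕ} {A : Matrix (Fin n) (Fin n) ℝ} {C : Matrix (Fin s) (Fin n) ℝ}

/-- Existence of the multi-input controller canonical form of an observable pair. -/
theorem IsObservablePair.exists_canonicalTransformation (h : IsObservablePair A C) :
    ∃ (p : ℕ) (r : Fin p → ℕ) (a : ∀ j, Fin (r j) → ℝ) (π : Fin p → Fin s)
      (T : Matrix (Σ j, Fin (r j)) (Fin n) ℝ) (S : Matrix (Fin n) (Σ j, Fin (r j)) ℝ),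
      IsCanonicalTransformation A C r a π T S := by
  classical
  let f : (Fin n → ℝ) →ₗ[ℝ] (Fin n → ℝ) := Aᵀ.mulVecLin
  have step : ∀ V : {V : Submodule ℝ (Fin n → ℝ) // (∀ v ∈ V, f v ∈ V) ∧ V ≠ ⊤},
      ∃ (c : Fin s) (r : ℕ) (a : Fin r → ℝ) (e : Fin r → (Fin n → ℝ)), 0 < r ∧
      (∀ i : Fin r, (i : ℕ) + 1 = r → e i = C c) ∧
      (∀ i i' : Fin r, (i : ℕ) + 1 = i' → f (e i') = e i - a i' • C c) ∧
      (∀ i : Fin r, (i : ℕ) = 0 → f (e i) + a i • C c ∈ V.1) ∧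
      Module.finrank ℝ (V.1 ⊔ Submodule.span ℝ (range e) : Submodule ℝ (Fin n → ℝ)) =
        Module.finrank ℝ V.1 + r := fun V => by
    obtain ⟨c, hc⟩ := h.exists_row_notMem V.2.1 V.2.2
    exact ⟨c, exists_cyclic_block f hc⟩
  choose c r a e hr hlast hchain hfirst hfin using step
  -- Adjoin one cyclic block while the space is proper and invariant. The default value `V` only
  -- makes the iteration total.
  let next : Submodule ℝ (Fin n → ℝ) → Submodule ℝ (Fin n → ℝ) := fun V =>
    if hV : (∀ v ∈ V, f v ∈ V) ∧ V ≠ ⊤ then V ⊔ Submodule.span ℝ (range (e ⟨V, hV⟩)) else V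
  let Vs : ℕ → Submodule ℝ (Fin n → ℝ) := fun q => next^[q] ⊥
  have hVs : ∀ q, Vs (q + 1) = next (Vs q) := fun q => Function.iterate_succ_apply' _ _ _
  have hinv : ∀ q, ∀ v ∈ Vs q, f v ∈ Vs q := by
    intro q
    induction q with
    | zero =>
      intro v hv
      obtain rfl : v = 0 := by simpa [Vs] using hv
      simp
    | succ q ih =>
      rw [hVs]
      by_cases hV : (∀ v ∈ Vs q, f v ∈ Vs q) ∧ Vs q ≠ ⊤
      · simp only [next, dif_pos hV]
        set V : {V : Submodule ℝ (Fin n → ℝ) // (∀ v ∈ V, f v ∈ V) ∧ V ≠ ⊤} := ⟨Vs q, hV⟩ with hVdef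
        suffices hle : Vs q ⊔ Submodule.span ℝ (range (e V)) ≤
            (Vs q ⊔ Submodule.span ℝ (range (e V))).comap f by
          exact fun v hv => hle hv
        have hmem : ∀ i, e V i ∈ Vs q ⊔ Submodule.span ℝ (range (e V)) := fun i =>
          Submodule.mem_sup_right (Submodule.subset_span ⟨i, rfl⟩)
        have hCm : C (c V) ∈ Vs q ⊔ Submodule.span ℝ (range (e V)) := by
          rw [← hlast V ⟨r V - 1, by have := hr V; omega⟩ (by have := hr V; simp; omega)]
          exact hmem _
        refine sup_le (fun v hv => Submodule.mem_sup_left (ih v hv)) (Submodule.span_le.2 ?_)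
        rintro _ ⟨i, rfl⟩
        rcases Nat.eq_zero_or_pos (i : ℕ) with hi | hi
        · have h1 := Submodule.sub_mem _ (Submodule.mem_sup_left (hfirst V i hi))
            (Submodule.smul_mem _ (a V i) hCm)
          rwa [add_sub_cancel_right] at h1
        · have h1 := hchain V ⟨i - 1, by omega⟩ i (by simp; omega)
          change f (e V i) ∈ Vs q ⊔ Submodule.span ℝ (range (e V))
          rw [h1]
          exact Submodule.sub_mem _ (hmem _) (Submodule.smul_mem _ _ hCm)
      · simp only [next, dif_neg hV]
        exact ih
  have hVs' : ∀ q (hq : Vs q ≠ ⊤),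
      Vs (q + 1) = Vs q ⊔ Submodule.span ℝ (range (e ⟨Vs q, hinv q, hq⟩)) := fun q hq => by
    rw [hVs]
    exact dif_pos ⟨hinv q, hq⟩
  have hVfin : ∀ q (hq : Vs q ≠ ⊤), Module.finrank ℝ (Vs (q + 1)) =
      Module.finrank ℝ (Vs q) + r ⟨Vs q, hinv q, hq⟩ := fun q hq => by
    rw [hVs' q hq]
    exact hfin ⟨Vs q, hinv q, hq⟩
  have hgrow : ∀ q, (∀ i < q, Vs i ≠ ⊤) → q ≤ Module.finrank ℝ (Vs q) := by
    intro q hq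
    induction q with
    | zero => exact Nat.zero_le _
    | succ q ih =>
      have h1 := ih fun i hi => hq i (hi.trans q.lt_succ_self)
      rw [hVfin q (hq q q.lt_succ_self)]
      have := hr ⟨Vs q, hinv q, hq q q.lt_succ_self⟩
      omega
  have hex : ∃ q, Vs q = ⊤ := by
    by_contra! hne
    have h1 := hgrow (Module.finrank ℝ (Fin n → ℝ) + 1) fun i _ => hne i
    have h2 := (Vs (Module.finrank ℝ (Fin n → ℝ) + 1)).finrank_le
    omega
  set p := Nat.find hex with hp
  have hptop : Vs p = ⊤ := Nat.find_spec hex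
  have hpne : ∀ j < p, Vs j ≠ ⊤ := fun j hj => Nat.find_min hex hj
  let V : Fin p → {V : Submodule ℝ (Fin n → ℝ) // (∀ v ∈ V, f v ∈ V) ∧ V ≠ ⊤} :=
    fun j => ⟨Vs j, hinv j, hpne j j.2⟩
  let b : (Σ j, Fin (r (V j))) → (Fin n → ℝ) := fun x => e (V x.1) x.2
  have hVsle : ∀ q ≤ p, Vs q ≤ Submodule.span ℝ (range b) := by
    intro q hq
    induction q with
    | zero => exact bot_le
    | succ q ih =>
      rw [hVs' q (hpne q hq)]
      refine sup_le (ih (by omega)) (Submodule.span_mono ?_)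
      rintro _ ⟨i, rfl⟩
      exact ⟨⟨⟨q, hq⟩, i⟩, rfl⟩
  -- The chains span, and their lengths add up to the dimension; independence follows by counting.
  have hcard : Fintype.card (Σ j, Fin (r (V j))) = Module.finrank ℝ (Fin n → ℝ) := by
    have h1 : ∀ q (hq : q ≤ p), Module.finrank ℝ (Vs q) =
        ∑ j : Fin q, r (V ⟨j, j.2.trans_le hq⟩) := by
      intro q hq
      induction q with
      | zero =>
        rw [show Vs 0 = ⊥ from rfl, finrank_bot]
        rfl
      | succ q ih =>
        rw [hVfin q (hpne q hq), Fin.sum_univ_castSucc, ih (by omega)]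
        rfl
    have h2 := h1 p le_rfl
    rw [hptop, finrank_top] at h2
    rw [h2, Fintype.card_sigma]
    simp
  let B := basisOfTopLeSpanOfCardEqFinrank b (hptop ▸ hVsle p le_rfl) hcard
  have hB : ∀ x, B x = b x := fun x => by simp [B]
  -- `Vs q` is spanned by the blocks before `q`, so it is invisible to the coordinates of block `k ≥
  -- q`. This gives the triangular shape: the remainder of a chain's first vector lies in the
  -- preceding blocks.
  have hcoord : ∀ (k : Fin p) (i : Fin (r (V k))) (q : ℕ), q ≤ k →
      Vs q ≤ LinearMap.ker (B.coord ⟨k, i⟩) := by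
    intro k i q hq
    induction q with
    | zero => exact bot_le
    | succ q ih =>
      rw [hVs' q (hpne q (by omega))]
      refine sup_le (ih (by omega)) (Submodule.span_le.2 ?_)
      rintro _ ⟨i', rfl⟩
      have h1 : e ⟨Vs q, hinv q, hpne q (by omega)⟩ i' = B ⟨⟨q, by omega⟩, i'⟩ := by rw [hB]
      have h2 : (⟨⟨q, by omega⟩, i'⟩ : Σ j, Fin (r (V j))) ≠ ⟨k, i⟩ := by
        intro h3
        have h4 := congrArg (fun x : Σ j, Fin (r (V j)) => (x.1 : ℕ)) h3
        simp only at h4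
        omega
      rw [SetLike.mem_coe, LinearMap.mem_ker, h1, Module.Basis.coord_apply,
        Module.Basis.repr_self, Finsupp.single_apply, if_neg h2]
  let T : Matrix (Σ j, Fin (r (V j))) (Fin n) ℝ := LinearMap.toMatrix' B.equivFun.toLinearMap
  let S : Matrix (Fin n) (Σ j, Fin (r (V j))) ℝ :=
    LinearMap.toMatrix' B.equivFun.symm.toLinearMap
  have hT : ∀ x, T *ᵥ x = B.equivFun x := fun x => LinearMap.toMatrix'_mulVec _ x
  have hS : ∀ y, S *ᵥ (Pi.single y 1) = b y := fun y => by
    rw [LinearMap.toMatrix'_mulVec]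
    simp [hB]
  have hent : ∀ x y, (T * Aᵀ * S) x y = B.coord x (f (b y)) := fun x y => by
    have h1 : (T * Aᵀ * S) *ᵥ (Pi.single y 1) = B.equivFun (f (b y)) := by
      rw [← mulVec_mulVec, hS, ← mulVec_mulVec, hT]
      rfl
    rw [mulVec_single_one] at h1
    exact congrFun h1 x
  have hBb : ∀ x y, B.coord x (b y) = if y = x then 1 else 0 := fun x y => by
    rw [← hB, Module.Basis.coord_apply, Module.Basis.repr_self, Finsupp.single_apply]
  have hlastb : ∀ j, C (c (V j)) = b ⟨j, ⟨r (V j) - 1, by have := hr (V j); omega⟩⟩ := fun j =>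
    (hlast (V j) ⟨r (V j) - 1, by have := hr (V j); omega⟩
      (by have := hr (V j); simp; omega)).symm
  have hzero : ∀ k j : Fin p, ∀ (i : Fin (r (V k))) (i' : Fin (r (V j))), j ≤ k → (i' : ℕ) = 0 →
      B.coord ⟨k, i⟩ (f (b ⟨j, i'⟩)) = -a (V j) i' * B.coord ⟨k, i⟩ (C (c (V j))) := by
    intro k j i i' hjk hi'
    have h1 := hcoord k i j hjk (hfirst (V j) i' hi')
    rw [LinearMap.mem_ker, map_add, map_smul, smul_eq_mul] at h1
    linarith
  have hpos : ∀ k j : Fin p, ∀ (i : Fin (r (V k))) (i' : Fin (r (V j))) (hi' : (i' : ℕ) ≠ 0),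
      B.coord ⟨k, i⟩ (f (b ⟨j, i'⟩)) = B.coord ⟨k, i⟩ (b ⟨j, ⟨i' - 1, by omega⟩⟩) -
        a (V j) i' * B.coord ⟨k, i⟩ (C (c (V j))) := by
    intro k j i i' hi'
    have h1 := hchain (V j) ⟨i' - 1, by omega⟩ i' (by simp; omega)
    rw [show f (b ⟨j, i'⟩) = _ from h1, map_sub, map_smul, smul_eq_mul]
  have hneq : ∀ {k j : Fin p} (i : Fin (r (V k))) (i' : Fin (r (V j))), j ≠ k →
      (⟨j, i'⟩ : Σ j, Fin (r (V j))) ≠ ⟨k, i⟩ := fun i i' hjk h => hjk (congrArg Sigma.fst h)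
  refine ⟨p, fun j => r (V j), fun j => a (V j), fun j => c (V j), T, S, fun j => hr (V j),
    ?_, ?_, ?_, ?_, ?_, ?_⟩
  · rw [← LinearMap.toMatrix'_comp]
    simp
  · rw [← LinearMap.toMatrix'_comp]
    simp
  · intro j i i'
    have hrj := hr (V j)
    have hi := i.2
    have hi'2 := i'.2
    rw [hent]
    by_cases hi' : (i' : ℕ) = 0
    · rw [hzero j j i i' le_rfl hi', hlastb, hBb]
      simp only [companion, of_apply, Sigma.mk.injEq, heq_eq_eq, true_and, Fin.ext_iff]
      rw [if_neg (show ¬ (i : ℕ) + 1 = i' by omega)]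
      by_cases hl : (i : ℕ) + 1 = r (V j)
      · rw [if_pos (by omega), if_pos hl, mul_one]
      · rw [if_neg (by omega), if_neg hl, mul_zero]
    · rw [hpos j j i i' hi', hlastb, hBb, hBb]
      simp only [companion, of_apply, Sigma.mk.injEq, heq_eq_eq, true_and, Fin.ext_iff]
      by_cases h1 : (i : ℕ) + 1 = i'
      · rw [if_pos (by omega), if_neg (by omega), if_pos h1]
        simp
      · rw [if_neg (by omega), if_neg h1]
        by_cases hl : (i : ℕ) + 1 = r (V j)
        · rw [if_pos (by omega), if_pos hl]
          simp
        · rw [if_neg (by omega), if_neg hl]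
          simp
  · intro k j hjk i i'
    rw [hent]
    by_cases hi' : (i' : ℕ) = 0
    · rw [hzero k j i i' hjk.le hi', hlastb, hBb, if_neg (hneq _ _ hjk.ne), mul_zero]
    · rw [hpos k j i i' hi', hlastb, hBb, hBb, if_neg (hneq _ _ hjk.ne),
        if_neg (hneq _ _ hjk.ne)]
      simp
  · intro k j hkj i i' hi'
    rw [hent, hpos k j i i' hi', hlastb, hBb, hBb, if_neg (hneq _ _ hkj.ne'),
      if_neg (hneq _ _ hkj.ne')]
    simp
  · intro k i j
    have h1 : (T * Cᵀ) ⟨k, i⟩ (c (V j)) = B.coord ⟨k, i⟩ (C (c (V j))) := by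
      have h2 : (T * Cᵀ) ⟨k, i⟩ (c (V j)) = (T *ᵥ C (c (V j))) ⟨k, i⟩ := rfl
      rw [h2, hT]
      rfl
    rw [h1, hlastb, hBb]
    by_cases hkj : k = j
    · subst hkj
      have := i.2
      simp only [Sigma.mk.injEq, heq_eq_eq, true_and, Fin.ext_iff]
      congr 1
      simp only [eq_iff_iff]
      omega
    · rw [if_neg (hneq _ _ (Ne.symm hkj)), if_neg fun hh => hkj hh.1]

end Existence

/-! ### Calculus of functions with bounded derivatives on the half-line -/

/-- The function is `m` times differentiable on `[0, ∞)`, with continuous and bounded `m`-th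
derivative there and bounded lower derivatives. -/
def BddSmooth : ℕ → (ℝ → ℝ) → Prop
  | 0, f => ContinuousOn f (Ici 0) ∧ ∃ M, ∀ t ≥ 0, |f t| ≤ M
  | m + 1, f => DifferentiableOn ℝ f (Ici 0) ∧ (∃ M, ∀ t ≥ 0, |f t| ≤ M) ∧
      BddSmooth m (derivWithin f (Ici 0))

namespace BddSmooth

variable {m : ℕ} {f f' g : ℝ → ℝ}

lemma bdd (hf : BddSmooth m f) : ∃ M, ∀ t ≥ 0, |f t| ≤ M := by
  cases m with
  | zero => exact hf.2
  | succ m => exact hf.2.1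

lemma continuousOn (hf : BddSmooth m f) : ContinuousOn f (Ici 0) := by
  cases m with
  | zero => exact hf.1
  | succ m => exact hf.1.continuousOn

lemma hasDerivWithinAt (hf : BddSmooth (m + 1) f) {t : ℝ} (ht : 0 ≤ t) :
    HasDerivWithinAt f (derivWithin f (Ici 0) t) (Ici 0) t :=
  (hf.1 t ht).hasDerivWithinAt

lemma congr (hf : BddSmooth m f) (h : EqOn g f (Ici 0)) : BddSmooth m g := by
  induction m generalizing f g with
  | zero =>
    obtain ⟨hc, M, hM⟩ := hf
    exact ⟨hc.congr h, M, fun t ht => by rw [h ht]; exact hM t ht⟩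
  | succ m ih =>
    obtain ⟨hd, ⟨M, hM⟩, h'⟩ := hf
    exact ⟨hd.congr h, ⟨M, fun t ht => by rw [h ht]; exact hM t ht⟩,
      ih h' fun t ht => derivWithin_congr h (h ht)⟩

lemma of_hasDerivWithinAt (hb : ∃ M, ∀ t ≥ 0, |f t| ≤ M)
    (hd : ∀ t ≥ 0, HasDerivWithinAt f (f' t) (Ici 0) t) (h : BddSmooth m f') :
    BddSmooth (m + 1) f :=
  ⟨fun t ht => (hd t ht).differentiableWithinAt, hb,
    h.congr fun t ht => (hd t ht).derivWithin (uniqueDiffOn_Ici 0 t ht)⟩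

lemma of_succ (hf : BddSmooth (m + 1) f) : BddSmooth m f := by
  induction m generalizing f with
  | zero => exact ⟨hf.continuousOn, hf.bdd⟩
  | succ m ih => exact ⟨hf.1, hf.2.1, ih hf.2.2⟩

lemma mono {l : ℕ} (hf : BddSmooth m f) (hl : l ≤ m) : BddSmooth l f := by
  induction m, hl using Nat.le_induction with
  | base => exact hf
  | succ m _ ih => exact ih hf.of_succ

lemma const (c : ℝ) : BddSmooth m fun _ => c := by
  induction m generalizing c with
  | zero => exact ⟨continuousOn_const, |c|, fun _ _ => le_rfl⟩
  | succ m ih =>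
    exact of_hasDerivWithinAt ⟨|c|, fun _ _ => le_rfl⟩
      (fun t _ => hasDerivWithinAt_const t _ c) (ih 0)

lemma add (hf : BddSmooth m f) (hg : BddSmooth m g) : BddSmooth m fun t => f t + g t := by
  have hb : ∃ M, ∀ t ≥ 0, |f t + g t| ≤ M := by
    obtain ⟨M, hM⟩ := hf.bdd
    obtain ⟨M', hM'⟩ := hg.bdd
    exact ⟨M + M', fun t ht => (abs_add_le _ _).trans (add_le_add (hM t ht) (hM' t ht))⟩
  induction m generalizing f g with
  | zero => exact ⟨hf.1.add hg.1, hb⟩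
  | succ m ih =>
    exact of_hasDerivWithinAt hb
      (fun t ht => (hf.hasDerivWithinAt ht).add (hg.hasDerivWithinAt ht))
      (ih hf.2.2 hg.2.2 (by
        obtain ⟨M, hM⟩ := hf.2.2.bdd
        obtain ⟨M', hM'⟩ := hg.2.2.bdd
        exact ⟨M + M', fun t ht => (abs_add_le _ _).trans (add_le_add (hM t ht) (hM' t ht))⟩))

lemma mul (hf : BddSmooth m f) (hg : BddSmooth m g) : BddSmooth m fun t => f t * g t := by
  have hb : ∀ {l} {f g : ℝ → ℝ}, BddSmooth l f → BddSmooth l g →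
      ∃ M, ∀ t ≥ 0, |f t * g t| ≤ M := by
    intro l f g hf hg
    obtain ⟨M, hM⟩ := hf.bdd
    obtain ⟨M', hM'⟩ := hg.bdd
    refine ⟨M * M', fun t ht => ?_⟩
    rw [abs_mul]
    exact mul_le_mul (hM t ht) (hM' t ht) (abs_nonneg _) ((abs_nonneg _).trans (hM t ht))
  induction m generalizing f g with
  | zero => exact ⟨hf.1.mul hg.1, hb hf hg⟩
  | succ m ih =>
    exact of_hasDerivWithinAt (hb hf hg)
      (fun t ht => (hf.hasDerivWithinAt ht).mul (hg.hasDerivWithinAt ht))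
      ((ih hf.2.2 hg.of_succ).add (ih hf.of_succ hg.2.2))

lemma const_mul (hf : BddSmooth m f) (c : ℝ) : BddSmooth m fun t => c * f t := (const c).mul hf

lemma pow (hf : BddSmooth m f) (k : ℕ) : BddSmooth m fun t => f t ^ k := by
  induction k with
  | zero => simpa using const (m := m) 1
  | succ k ih => simpa only [pow_succ] using ih.mul hf

lemma sum {ι : Type*} {s : Finset ι} {F : ι → ℝ → ℝ} (h : ∀ i ∈ s, BddSmooth m (F i)) :
    BddSmooth m fun t => ∑ i ∈ s, F i t := by
  classical
  induction s using Finset.induction_on with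
  | empty => simpa using const (m := m) 0
  | insert i s hi ih =>
    simp only [Finset.sum_insert hi]
    exact (h i (Finset.mem_insert_self _ _)).add
      (ih fun j hj => h j (Finset.mem_insert_of_mem hj))

end BddSmooth

lemma IsBoundedSmooth.bddSmooth {q : ℕ} {g : ℝ → ℝ} (h : IsBoundedSmooth q g) :
    BddSmooth q g := by
  induction q generalizing g with
  | zero =>
    obtain ⟨hc, hb⟩ := h
    obtain ⟨M, hM⟩ := hb 0 le_rfl
    exact ⟨hc.continuousOn, M, fun t ht => by simpa using hM t ht⟩
  | succ q ih =>
    obtain ⟨hc, hb⟩ := h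
    obtain ⟨M, hM⟩ := hb 0 (Nat.zero_le _)
    push_cast at hc
    obtain ⟨hd, -, hc'⟩ := (contDiffOn_succ_iff_derivWithin (uniqueDiffOn_Ici 0)).1 hc
    refine ⟨hd, ⟨M, fun t ht => by simpa using hM t ht⟩, ih ⟨hc', fun l hl => ?_⟩⟩
    obtain ⟨M', hM'⟩ := hb (l + 1) (by omega)
    exact ⟨M', fun t ht => by rw [← iteratedDerivWithin_succ']; exact hM' t ht⟩

/-! ### The coefficients of powers of `D + φ` -/

/-- The sequence `b 0 = 1`, `b (q+1) = φ b q - (b q)'`, in terms of which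
`(D + φ)^i = ∑ m, D^m ∘ (i.choose m) b (i-m)`. -/
noncomputable def appell (φ : ℝ → ℝ) : ℕ → ℝ → ℝ
  | 0 => fun _ => 1
  | q + 1 => fun t => φ t * appell φ q t - derivWithin (appell φ q) (Ici 0) t

/-- By Pascal's rule the binomial multiples of `appell` satisfy the recursion of `shiftCoeff`. Where
the truncated difference `i - m` is not genuine, the binomial coefficient is zero. -/
lemma shiftCoeff_eq (φ : ℝ → ℝ) (i m : ℕ) :
    shiftCoeff φ i m = fun t => (i.choose m : ℝ) * appell φ (i - m) t := by
  induction i generalizing m with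
  | zero =>
    cases m with
    | zero => simp [shiftCoeff, appell]
    | succ m => simp [shiftCoeff]
  | succ i ih =>
    cases m with
    | zero =>
      funext t
      have h0 := ih 0
      simp only [Nat.choose_zero_right, Nat.cast_one, one_mul, Nat.sub_zero] at h0 ⊢
      simp only [shiftCoeff, h0, appell]
    | succ m =>
      funext t
      simp only [shiftCoeff, ih, derivWithin_const_mul_field, Nat.choose_succ_succ,
        Nat.succ_sub_succ, Nat.cast_add]
      rcases lt_or_ge m i with h | h
      · have h1 : i - m = i - (m + 1) + 1 := by omega
        rw [h1]
        simp only [appell]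
        ring
      · simp [Nat.choose_eq_zero_of_lt (Nat.lt_succ_of_le h)]

section Appell

variable {g ρ : ℝ → ℝ} {N k : ℕ}

/-- Each step of the recursion differentiates once, which costs at most one factor `g` and one order
of smoothness. The first step differentiates a constant, so it costs nothing; hence the exponent `k
- q` at index `q + 1`. -/
lemma exists_appell_eq (hg : BddSmooth N g) (hρ : BddSmooth N ρ) {q : ℕ} (hqk : q < k)
    (hqN : q ≤ N) : ∃ c, BddSmooth (N - q) c ∧
      ∀ t ≥ 0, appell (fun t => g t ^ k * ρ t) (q + 1) t = g t ^ (k - q) * c t := by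
  induction q with
  | zero =>
    refine ⟨ρ, hρ, fun t _ => ?_⟩
    have : derivWithin (appell (fun t => g t ^ k * ρ t) 0) (Ici 0) t = 0 := by
      simp [appell]
    simp only [appell] at this ⊢
    rw [this]
    simp
  | succ q ih =>
    obtain ⟨c, hc, hcb⟩ := ih (by omega) (by omega)
    obtain ⟨l, hl⟩ : ∃ l, N - q = l + 1 := ⟨N - q - 1, by omega⟩
    obtain ⟨e, he⟩ : ∃ e, k - q = e + 1 := ⟨k - q - 1, by omega⟩
    have hl' : N - (q + 1) = l := by omega
    have he' : k - (q + 1) = e := by omega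
    rw [hl] at hc
    rw [he] at hcb
    rw [hl', he']
    have hgl : BddSmooth (l + 1) g := hg.mono (by omega)
    have hρl : BddSmooth l ρ := hρ.mono (by omega)
    refine ⟨fun t => (g t ^ k * ρ t) * (g t * c t) + (-(e + 1) * (derivWithin g (Ici 0) t * c t)
      + -1 * (g t * derivWithin c (Ici 0) t)), ?_, fun t ht => ?_⟩
    · exact (((hgl.of_succ.pow k).mul hρl).mul (hgl.of_succ.mul hc.of_succ)).add
        (((hgl.2.2.mul hc.of_succ).const_mul _).add ((hgl.of_succ.mul hc.2.2).const_mul _))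
    · have h1 : HasDerivWithinAt (fun t => g t ^ (e + 1) * c t) _ (Ici 0) t :=
        ((hgl.hasDerivWithinAt ht).fun_pow (e + 1)).mul (hc.hasDerivWithinAt ht)
      have h2 := (h1.congr hcb (hcb t ht)).derivWithin (uniqueDiffOn_Ici 0 t ht)
      rw [appell]
      beta_reduce
      rw [h2, hcb t ht]
      push_cast
      ring

lemma exists_appell_eq_mul (hg : BddSmooth N g) (hρ : BddSmooth N ρ) {q : ℕ} (hqk : q + 1 ≤ k)
    (hqN : q ≤ N) : ∃ β, BddSmooth 0 β ∧
      ∀ t ≥ 0, appell (fun t => g t ^ k * ρ t) (q + 1) t = β t * g t := by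
  obtain ⟨c, hc, hcb⟩ := exists_appell_eq hg hρ hqk hqN
  refine ⟨fun t => g t ^ (k - q - 1) * c t,
    ((hg.mono (Nat.zero_le _)).pow _).mul (hc.mono (Nat.zero_le _)), fun t ht => ?_⟩
  rw [hcb t ht, show k - q = k - q - 1 + 1 by omega, pow_succ]
  simp only [Nat.add_sub_cancel]
  ring

lemma bddSmooth_appell (hg : BddSmooth N g) (hρ : BddSmooth N ρ) {q l : ℕ} (hqk : q ≤ k)
    (hqN : q + l ≤ N + 1) :
    BddSmooth l (appell (fun t => g t ^ k * ρ t) q) := by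
  cases q with
  | zero => exact BddSmooth.const 1
  | succ q =>
    obtain ⟨c, hc, hcb⟩ := exists_appell_eq hg hρ hqk (show q ≤ N by omega)
    exact (((hg.mono (by omega)).pow (k - q)).mul (hc.mono (by omega))).congr hcb

end Appell

section AppellInverse

variable {φ : ℝ → ℝ} {r : ℕ}

/-- The sequences of `φ` and `-φ` are inverse under binomial convolution. -/
lemma sum_choose_appell_mul
    (h₁ : ∀ q < r, DifferentiableOn ℝ (appell φ q) (Ici 0))
    (h₂ : ∀ q < r, DifferentiableOn ℝ (appell (fun t => -φ t) q) (Ici 0))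
    {q : ℕ} (hq : q ≤ r) {t : ℝ} (ht : 0 ≤ t) :
    ∑ j ∈ Finset.range (q + 1), (q.choose j : ℝ) *
      (appell (fun t => -φ t) j t * appell φ (q - j) t) = if q = 0 then 1 else 0 := by
  -- With `w = exp ∫ φ`, the sequence of `φ` is `w (-D)^q w⁻¹` and that of `-φ` is `w⁻¹ (-D)^q w`,
  -- so the sum is `(-D)^q (w⁻¹ w)` by Leibniz' rule. The induction avoids `w`: differentiating the
  -- identity of order `q` gives, by Pascal's rule, the one of order `q + 1`.
  induction q generalizing t with
  | zero => simp [appell]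
  | succ q ih =>
    have hconst : HasDerivWithinAt (fun t => ∑ j ∈ Finset.range (q + 1), (q.choose j : ℝ) *
        (appell (fun t => -φ t) j t * appell φ (q - j) t)) 0 (Ici 0) t :=
      (hasDerivWithinAt_const t (Ici 0) (if q = 0 then (1 : ℝ) else 0)).congr
        (fun s hs => ih (by omega) hs) (ih (by omega) ht)
    have hsum : HasDerivWithinAt (fun t => ∑ j ∈ Finset.range (q + 1), (q.choose j : ℝ) *
        (appell (fun t => -φ t) j t * appell φ (q - j) t))
        (∑ j ∈ Finset.range (q + 1), (q.choose j : ℝ) *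
          ((-φ t * appell (fun t => -φ t) j t - appell (fun t => -φ t) (j + 1) t) *
            appell φ (q - j) t + appell (fun t => -φ t) j t *
            (φ t * appell φ (q - j) t - appell φ (q - j + 1) t))) (Ici 0) t := by
      refine HasDerivWithinAt.fun_sum fun j hj => ?_
      have hj' := Finset.mem_range.1 hj
      have d1 := (h₂ j (by omega) t ht).hasDerivWithinAt
      have d2 := (h₁ (q - j) (by omega) t ht).hasDerivWithinAt
      refine ((d1.mul d2).const_mul (q.choose j : ℝ)).congr_deriv ?_
      simp only [appell]
      ring
    have h0 := (uniqueDiffOn_Ici (0 : ℝ) t ht).eq_deriv _ hsum hconst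
    have h1 : ∑ j ∈ Finset.range (q + 1), (q.choose j : ℝ) *
        (appell (fun t => -φ t) (j + 1) t * appell φ (q - j) t) +
        ∑ j ∈ Finset.range (q + 1), (q.choose j : ℝ) *
        (appell (fun t => -φ t) j t * appell φ (q - j + 1) t) = 0 := by
      rw [← neg_eq_zero, ← h0, ← Finset.sum_add_distrib, ← Finset.sum_neg_distrib]
      exact Finset.sum_congr rfl fun j _ => by ring
    rw [if_neg (Nat.succ_ne_zero q), ← h1, Finset.sum_range_succ']
    have h2 : ∑ j ∈ Finset.range (q + 1), (q.choose j : ℝ) *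
        (appell (fun t => -φ t) j t * appell φ (q - j + 1) t) =
        ∑ j ∈ Finset.range (q + 1), (q.choose (j + 1) : ℝ) *
        (appell (fun t => -φ t) (j + 1) t * appell φ (q - j) t) +
        appell (fun t => -φ t) 0 t * appell φ (q + 1) t := by
      rw [Finset.sum_range_succ', Finset.sum_range_succ _ q]
      simp only [Nat.choose_succ_self, Nat.choose_zero_right, Nat.cast_zero, zero_mul, add_zero,
        Nat.cast_one, one_mul, Nat.sub_zero]
      congr 1
      refine Finset.sum_congr rfl fun j hj => ?_
      have hj' := Finset.mem_range.1 hj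
      rw [show q - (j + 1) + 1 = q - j by omega]
    rw [h2, ← add_assoc, ← Finset.sum_add_distrib]
    simp only [Nat.choose_succ_succ, Nat.choose_zero_right, Nat.cast_one, one_mul, Nat.sub_zero,
      Nat.succ_sub_succ, Nat.cast_add, add_mul, Nat.succ_eq_add_one]

/-- The Pascal-type matrices of the sequences of `φ` and `-φ` are inverse to each other. -/
lemma sum_choose_mul_choose_appell
    (h₁ : ∀ q < r, DifferentiableOn ℝ (appell φ q) (Ici 0))
    (h₂ : ∀ q < r, DifferentiableOn ℝ (appell (fun t => -φ t) q) (Ici 0))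
    {l i M : ℕ} (hl : l ≤ r) (hlM : l < M) {t : ℝ} (ht : 0 ≤ t) :
    ∑ j ∈ Finset.range M, ((j.choose i : ℝ) * appell (fun t => -φ t) (j - i) t) *
      ((l.choose j : ℝ) * appell φ (l - j) t) = if l = i then 1 else 0 := by
  rcases lt_or_ge l i with hli | hil
  · rw [if_neg hli.ne]
    refine Finset.sum_eq_zero fun j _ => ?_
    rcases lt_or_ge j i with h | h
    · simp [Nat.choose_eq_zero_of_lt h]
    · simp [Nat.choose_eq_zero_of_lt (hli.trans_le h)]
  · obtain ⟨d, rfl⟩ := Nat.exists_eq_add_of_le hil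
    have hsub : ∑ j ∈ Finset.range M, ((j.choose i : ℝ) * appell (fun t => -φ t) (j - i) t) *
        (((i + d).choose j : ℝ) * appell φ (i + d - j) t) =
        ∑ j ∈ Finset.Ico i (i + d + 1), ((j.choose i : ℝ) * appell (fun t => -φ t) (j - i) t) *
        (((i + d).choose j : ℝ) * appell φ (i + d - j) t) := by
      symm
      refine Finset.sum_subset (fun j hj => ?_) fun j _ hj => ?_
      · rw [Finset.mem_Ico] at hj
        exact Finset.mem_range.2 (by omega)
      · rw [Finset.mem_Ico] at hj
        rcases lt_or_ge j i with h | h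
        · simp [Nat.choose_eq_zero_of_lt h]
        · simp [Nat.choose_eq_zero_of_lt (show i + d < j by omega)]
    rw [hsub, Finset.sum_Ico_eq_sum_range, show i + d + 1 - i = d + 1 by omega]
    -- The identity `C(l, j) C(j, i) = C(l, i) C(l - i, j - i)` reduces the matrix product to a
    -- binomial convolution of order `l - i`.
    have hterm : ∀ p ∈ Finset.range (d + 1),
        (((i + p).choose i : ℝ) * appell (fun t => -φ t) (i + p - i) t) *
        (((i + d).choose (i + p) : ℝ) * appell φ (i + d - (i + p)) t) =
        ((i + d).choose i : ℝ) * ((d.choose p : ℝ) *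
          (appell (fun t => -φ t) p t * appell φ (d - p) t)) := by
      intro p hp
      have hp' := Finset.mem_range.1 hp
      have h3 := Nat.choose_mul (n := i + d) (k := i + p) (s := i) (by omega)
      rw [show i + d - i = d by omega, show i + p - i = p by omega] at h3
      have h4 : ((i + d).choose (i + p) : ℝ) * (i + p).choose i = (i + d).choose i * d.choose p := by
        exact_mod_cast h3
      rw [show i + p - i = p by omega, show i + d - (i + p) = d - p by omega]
      linear_combination (appell (fun t => -φ t) p t * appell φ (d - p) t) * h4
    rw [Finset.sum_congr rfl hterm, ← Finset.mul_sum,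
      sum_choose_appell_mul h₁ h₂ (show d ≤ r by omega) ht]
    by_cases hd : d = 0
    · simp [hd]
    · rw [if_neg hd, if_neg (by omega), mul_zero]

end AppellInverse

/-! ### Bounds for the persistence filter -/

section PersistenceFilter

variable {g R : ℝ → ℝ} {k : ℕ} {lam : ℝ}

/-- The integrating factor of the filter. The case `c = 0` gives the integral formula behind the
lower bound; `c = M / lam`, with `M` a bound of `g ^ k`, gives the upper bound. -/
lemma IsPersistenceFilter.hasDerivWithinAt_exp_mul (hR : IsPersistenceFilter g k lam R) (c : ℝ)
    {t : ℝ} (ht : 0 ≤ t) :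
    HasDerivWithinAt (fun t => Real.exp (lam * t) * (R t - c))
      (Real.exp (lam * t) * (g t ^ k - lam * c)) (Ici 0) t := by
  have h1 : HasDerivWithinAt (fun t => Real.exp (lam * t)) (Real.exp (lam * t) * (lam * 1))
      (Ici 0) t := ((hasDerivWithinAt_id t (Ici 0)).const_mul lam).exp
  exact (h1.mul ((hR.2 t ht).sub_const c)).congr_deriv (by ring)

lemma IsPersistenceFilter.continuousOn (hR : IsPersistenceFilter g k lam R) :
    ContinuousOn R (Ici 0) := fun t ht => (hR.2 t ht).continuousWithinAt

lemma IsPersistenceFilter.exp_mul_sub (hR : IsPersistenceFilter g k lam R)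
    (hg : ContinuousOn g (Ici 0)) {s t : ℝ} (hs : 0 ≤ s) (hst : s ≤ t) :
    ∫ τ in s..t, Real.exp (lam * τ) * g τ ^ k =
      Real.exp (lam * t) * R t - Real.exp (lam * s) * R s := by
  have hsub : Icc s t ⊆ Ici 0 := fun τ hτ => hs.trans hτ.1
  have hd : ∀ τ ≥ 0, HasDerivWithinAt (fun t => Real.exp (lam * t) * R t)
      (Real.exp (lam * τ) * g τ ^ k) (Ici 0) τ := fun τ hτ => by
    simpa using hR.hasDerivWithinAt_exp_mul 0 hτ
  refine intervalIntegral.integral_eq_sub_of_hasDeriv_right_of_le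
    (f := fun t => Real.exp (lam * t) * R t) hst
    (fun τ hτ => ((hd τ (hsub hτ)).continuousWithinAt).mono hsub)
    (fun τ hτ => (hd τ (hs.trans hτ.1.le)).mono
      (Ioi_subset_Ici (hs.trans hτ.1.le))) ?_
  refine ContinuousOn.intervalIntegrable ?_
  rw [uIcc_of_le hst]
  exact ContinuousOn.mul (by fun_prop) ((hg.mono hsub).pow k)

/-- A persistence filter driven by a bounded, persistently exciting signal stays between positive
constants. -/
theorem IsPersistenceFilter.exists_bounds (hR : IsPersistenceFilter g k lam R)
    (hg : BddSmooth 0 g) (hPE : IsPE g) (hk : Even k) (hk2 : 2 ≤ k) (hlam : 0 < lam) :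
    ∃ R₁ > 0, ∃ R₂, ∀ t ≥ 0, R₁ ≤ R t ∧ R t ≤ R₂ := by
  have hgc := hg.continuousOn
  obtain ⟨α₁, hα₁, α₂, -, δ, hδ, hPE⟩ := hPE
  obtain ⟨M, hM⟩ := (hg.pow k).bdd
  have hmono : ∀ {s t}, 0 ≤ s → s ≤ t →
      Real.exp (lam * s) * R s ≤ Real.exp (lam * t) * R t := fun {s t} hs hst => by
    have h1 := hR.exp_mul_sub hgc hs hst
    have h2 : 0 ≤ ∫ τ in s..t, Real.exp (lam * τ) * g τ ^ k :=
      intervalIntegral.integral_nonneg hst fun τ _ => mul_nonneg (Real.exp_nonneg _) (hk.pow_nonneg _)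
    linarith
  have hpos : ∀ t ≥ 0, 0 < R t := fun t ht => by
    have h1 := hmono le_rfl ht
    have h2 : 0 < Real.exp (lam * t) * R t := lt_of_lt_of_le (by simpa using hR.1) h1
    exact (mul_pos_iff_of_pos_left (Real.exp_pos _)).1 h2
  obtain ⟨h, hh⟩ : ∃ h, k = 2 * (h + 1) := by
    obtain ⟨l, hl⟩ := hk
    exact ⟨l - 1, by omega⟩
  -- Half the guaranteed mean of `g ^ 2` over a window, so that subtracting `c` still leaves an
  -- integral of at least `α₁ / 2`.
  set c := α₁ / (2 * δ) with hc
  have hc0 : 0 < c := by positivity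
  -- This transfers the excitation from the square of `g` to its `k`-th power: where `g ^ 2 ≥ c` the
  -- surplus power is at least `c ^ h`, elsewhere the left side is not positive.
  have hpt : ∀ τ, c ^ h * (g τ ^ 2 - c) ≤ g τ ^ k := fun τ => by
    have hX : 0 ≤ g τ ^ 2 := sq_nonneg _
    rw [hh, pow_mul, pow_succ]
    rcases le_total c (g τ ^ 2) with h1 | h1
    · calc c ^ h * (g τ ^ 2 - c) ≤ c ^ h * g τ ^ 2 := by gcongr; linarith
        _ ≤ (g τ ^ 2) ^ h * g τ ^ 2 := by gcongr
    · refine le_trans (mul_nonpos_of_nonneg_of_nonpos (by positivity) (by linarith)) (by positivity)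
  have hlow : ∀ s ≥ 0, c ^ h * (α₁ / 2) ≤ Real.exp (lam * δ) * R (s + δ) := by
    intro s hs
    have hst : s ≤ s + δ := by linarith
    have hsub : Icc s (s + δ) ⊆ Ici 0 := fun τ hτ => hs.le.trans hτ.1
    have hi1 : IntervalIntegrable (fun τ => g τ ^ 2) MeasureTheory.volume s (s + δ) := by
      refine ContinuousOn.intervalIntegrable ?_
      rw [uIcc_of_le hst]
      exact (hgc.mono hsub).pow 2
    have hi2 : IntervalIntegrable (fun τ => Real.exp (lam * τ) * g τ ^ k) MeasureTheory.volume s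
        (s + δ) := by
      refine ContinuousOn.intervalIntegrable ?_
      rw [uIcc_of_le hst]
      exact ContinuousOn.mul (by fun_prop) ((hgc.mono hsub).pow k)
    have h1 : ∫ τ in s..(s + δ), Real.exp (lam * s) * (c ^ h * (g τ ^ 2 - c)) ≤
        ∫ τ in s..(s + δ), Real.exp (lam * τ) * g τ ^ k := by
      refine intervalIntegral.integral_mono_on hst
        (((hi1.sub intervalIntegrable_const).const_mul _).const_mul _) hi2 fun τ hτ => ?_
      refine mul_le_mul_of_nonneg_left (hpt τ) (Real.exp_nonneg _) |>.trans ?_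
      refine mul_le_mul_of_nonneg_right ?_ (hk.pow_nonneg _)
      exact Real.exp_le_exp.2 (mul_le_mul_of_nonneg_left hτ.1 hlam.le)
    rw [hR.exp_mul_sub hgc hs hst, intervalIntegral.integral_const_mul,
      intervalIntegral.integral_const_mul,
      intervalIntegral.integral_sub hi1 intervalIntegrable_const,
      intervalIntegral.integral_const, add_sub_cancel_left, smul_eq_mul] at h1
    have h2 : δ * c = α₁ / 2 := by rw [hc]; field_simp
    have h3 : c ^ h * (α₁ / 2) ≤ c ^ h * ((∫ τ in s..(s + δ), g τ ^ 2) - δ * c) := by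
      have := (hPE s hs).1
      gcongr
      linarith
    have h4 : 0 ≤ Real.exp (lam * s) * R s := (mul_pos (Real.exp_pos _) (hpos s hs)).le
    have h5 : Real.exp (lam * s) * (c ^ h * (α₁ / 2)) ≤
        Real.exp (lam * s) * (Real.exp (lam * δ) * R (s + δ)) := by
      calc _ ≤ Real.exp (lam * s) * (c ^ h * ((∫ τ in s..(s + δ), g τ ^ 2) - δ * c)) := by gcongr
        _ ≤ Real.exp (lam * (s + δ)) * R (s + δ) := by linarith
        _ = _ := by rw [mul_add, Real.exp_add, mul_assoc]
    exact le_of_mul_le_mul_left h5 (Real.exp_pos _)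
  refine ⟨min (c ^ h * (α₁ / 2)) (R 0) * Real.exp (-(lam * δ)),
    mul_pos (lt_min (by positivity) hR.1) (Real.exp_pos _), R 0 + M / lam, fun t ht => ⟨?_, ?_⟩⟩
  · have key : min (c ^ h * (α₁ / 2)) (R 0) ≤ Real.exp (lam * δ) * R t := by
      -- Before time `δ` no complete window has elapsed; there `R 0 > 0` supplies the bound.
      rcases le_total δ t with hδt | hδt
      · have h1 := hlow (t - δ) (sub_nonneg.2 hδt)
        rw [sub_add_cancel] at h1
        exact (min_le_left _ _).trans h1
      · have h1 := hmono le_rfl ht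
        rw [mul_zero, Real.exp_zero, one_mul] at h1
        refine (min_le_right _ _).trans (h1.trans ?_)
        exact mul_le_mul_of_nonneg_right
          (Real.exp_le_exp.2 (mul_le_mul_of_nonneg_left hδt hlam.le)) (hpos t ht).le
    rw [Real.exp_neg, ← div_eq_mul_inv, div_le_iff₀ (Real.exp_pos _), mul_comm (R t)]
    exact key
  · have hM0 : 0 ≤ M := (abs_nonneg _).trans (hM 0 le_rfl)
    have hanti : AntitoneOn (fun t => Real.exp (lam * t) * (R t - M / lam)) (Ici 0) := by
      refine antitoneOn_of_hasDerivWithinAt_nonpos (convex_Ici 0)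
        (fun t ht => (hR.hasDerivWithinAt_exp_mul (M / lam) ht).continuousWithinAt)
        (fun t ht => (hR.hasDerivWithinAt_exp_mul (M / lam) (interior_subset ht)).mono
          interior_subset) fun t ht => ?_
      have h1 := (le_abs_self _).trans (hM t (interior_subset ht))
      have h2 : lam * (M / lam) = M := by field_simp
      rw [h2]
      exact mul_nonpos_of_nonneg_of_nonpos (Real.exp_nonneg _) (by linarith)
    have h1 := hanti (mem_Ici.2 le_rfl) ht ht
    simp only [mul_zero, Real.exp_zero, one_mul] at h1
    by_contra! hlt
    have h2 : 1 ≤ Real.exp (lam * t) := Real.one_le_exp (by positivity)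
    have h3 : 0 < M / lam + R 0 := by have := hR.1; positivity
    have h4 : R t - M / lam ≤ Real.exp (lam * t) * (R t - M / lam) := by
      have h5 : 0 ≤ R t - M / lam := by have := hR.1; linarith
      nlinarith
    have h6 : 0 ≤ M / lam := by positivity
    linarith

/-- By the filter equation `ρ = 1 / (2 R)` satisfies `ρ' = lam ρ - 2 g ^ k ρ²`, so its smoothness
bootstraps from that of `g`. -/
lemma IsPersistenceFilter.bddSmooth_inv {N : ℕ} (hR : IsPersistenceFilter g k lam R)
    (hg : BddSmooth N g) {R₁ : ℝ} (hR₁ : 0 < R₁) (hRb : ∀ t ≥ 0, R₁ ≤ R t) :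
    BddSmooth N fun t => 1 / (2 * R t) := by
  have hpos : ∀ t ≥ 0, 0 < R t := fun t ht => hR₁.trans_le (hRb t ht)
  have hb : ∃ M, ∀ t ≥ 0, |1 / (2 * R t)| ≤ M := ⟨1 / (2 * R₁), fun t ht => by
    have := hpos t ht
    have := hRb t ht
    rw [abs_of_pos (by positivity)]
    gcongr⟩
  induction N with
  | zero =>
    exact ⟨continuousOn_const.div (continuousOn_const.mul hR.continuousOn)
      fun t ht => by have := hpos t ht; positivity, hb⟩
  | succ N ih =>
    have h1 := ih hg.of_succ
    refine BddSmooth.of_hasDerivWithinAt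
      (f' := fun t => lam * (1 / (2 * R t)) +
        -2 * (g t ^ k * (1 / (2 * R t) * (1 / (2 * R t))))) hb (fun t ht => ?_) ?_
    · have h0 := hpos t ht
      have h2 := ((hR.2 t ht).const_mul 2).fun_inv (by positivity)
      simp only [one_div]
      refine h2.congr_deriv ?_
      field_simp
      ring
    · exact (h1.const_mul _).add (((hg.of_succ.pow k).mul (h1.mul h1)).const_mul _)

end PersistenceFilter

/-! ### Change of state from the closed loop to the shifted companion system -/

section ShiftedState

variable {r : ℕ}

/-- The entries of a vector indexed from `1` and extended by zero. -/
def shiftEntry (v : Fin r → ℝ) (q : ℕ) : ℝ := ∑ j : Fin r, if (j : ℕ) + 1 = q then v j else 0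

@[simp] lemma shiftEntry_zero (v : Fin r → ℝ) : shiftEntry v 0 = 0 := by
  simp [shiftEntry]

lemma shiftEntry_succ (v : Fin r → ℝ) (j : Fin r) : shiftEntry v (j + 1) = v j := by
  rw [shiftEntry, Finset.sum_eq_single j]
  · simp
  · intro i _ hij
    rw [if_neg]
    intro h
    exact hij (Fin.ext (by omega))
  · simp

lemma companion_transpose_mulVec (a v : Fin r → ℝ) (i : Fin r) :
    ((companion a)ᵀ *ᵥ v) i = shiftEntry v i - a i * shiftEntry v r := by
  simp only [mulVec, dotProduct, transpose_apply, companion, of_apply, shiftEntry,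
    Finset.mul_sum, ← Finset.sum_sub_distrib]
  refine Finset.sum_congr rfl fun j _ => ?_
  have := i.2
  by_cases h1 : (j : ℕ) + 1 = i
  · rw [if_pos h1, if_pos h1, if_neg (by omega)]
    ring
  · rw [if_neg h1, if_neg h1]
    split_ifs <;> ring

lemma nominalError_mulVec (a : Fin r → ℝ) (g : ℝ → ℝ) (ℓ : ℝ → Fin r → ℝ) (t : ℝ)
    (v : Fin r → ℝ) (i : Fin r) :
    (nominalError a g ℓ t *ᵥ v) i =
      shiftEntry v i - (a i + ℓ t i * g t) * shiftEntry v r := by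
  have h1 : (fun j : Fin r => if (j : ℕ) + 1 = r then g t else 0) ⬝ᵥ v =
      g t * shiftEntry v r := by
    simp only [dotProduct, shiftEntry, Finset.mul_sum]
    exact Finset.sum_congr rfl fun j _ => by split_ifs <;> ring
  rw [nominalError, sub_mulVec, vecMulVec_mulVec, Pi.sub_apply, companion_transpose_mulVec, h1]
  simp only [Pi.smul_apply, MulOpposite.smul_eq_mul_unop, MulOpposite.unop_op]
  ring

/-- The coefficients of `P = X ^ r + ∑ i < r, a i X ^ i`. -/
def monicCoeff (a : Fin r → ℝ) (l : ℕ) : ℝ := if h : l < r then a ⟨l, h⟩ else 1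

/-- The coefficients `M` in `P(D + φ) = ∑ m, D^m ∘ M m`. -/
noncomputable def shiftedCoeff (a : Fin r → ℝ) (φ : ℝ → ℝ) (m : ℕ) (t : ℝ) : ℝ :=
  ∑ l ∈ Finset.range (r + 1), monicCoeff a l * ((l.choose m : ℝ) * appell φ (l - m) t)

lemma shiftedCoeff_self (a : Fin r → ℝ) (φ : ℝ → ℝ) (t : ℝ) : shiftedCoeff a φ r t = 1 := by
  rw [shiftedCoeff, Finset.sum_eq_single r]
  · simp [monicCoeff, appell]
  · intro l hl hlr
    have := Finset.mem_range.1 hl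
    rw [Nat.choose_eq_zero_of_lt (by omega)]
    simp
  · simp

/-- In the closed loop the gain thus replaces the coefficients of `P(D)` by those of `P(D + φ)`. -/
lemma shiftedCoeff_eq_add_filterGain (a : Fin r → ℝ) (g : ℝ → ℝ) (k : ℕ) (R : ℝ → ℝ) (t : ℝ)
    (m : Fin r) :
    shiftedCoeff a (fun τ => g τ ^ k / (2 * R τ)) m t = a m + filterGain a g k R t m := by
  rw [shiftedCoeff, Finset.sum_range_succ, Finset.sum_range, filterGain]
  simp only [shiftCoeff_eq]
  have h1 : monicCoeff a r = 1 := by simp [monicCoeff]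
  have h2 : ∀ i : Fin r, monicCoeff a i = a i := fun i => by simp [monicCoeff]
  simp only [h1, h2]
  ring

/-- The change of the state that turns `P(D + φ) y = 0` in observer form into a shifted companion
system. -/
noncomputable def pascalTransform (b : ℕ → ℝ) (z : ℕ → ℝ) (r i : ℕ) : ℝ :=
  ∑ j ∈ Finset.range r, (j.choose i : ℝ) * b (j - i) * z (j + 1)

/-- The transformation is triangular with unit diagonal, so it keeps the last state, through which
the companion coefficients act. -/
lemma pascalTransform_last (φ : ℝ → ℝ) (t : ℝ) (z : ℕ → ℝ) (r : ℕ) :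
    pascalTransform (fun q => appell φ q t) z (r + 1) r = z (r + 1) := by
  rw [pascalTransform, Finset.sum_range_succ, Finset.sum_eq_zero, zero_add]
  · simp [appell]
  · intro j hj
    rw [Nat.choose_eq_zero_of_lt (Finset.mem_range.1 hj)]
    simp

variable {φ : ℝ → ℝ}

lemma pascalTransform_pascalTransform
    (h₁ : ∀ q < r, DifferentiableOn ℝ (appell φ q) (Ici 0))
    (h₂ : ∀ q < r, DifferentiableOn ℝ (appell (fun t => -φ t) q) (Ici 0)) (z w : ℕ → ℝ) {t : ℝ}
    (ht : 0 ≤ t)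
    (hw : ∀ j < r, w (j + 1) = pascalTransform (fun q => appell (fun t => -φ t) q t) z r j)
    {i : ℕ} (hi : i < r) :
    pascalTransform (fun q => appell φ q t) w r i = z (i + 1) := by
  have hφ : φ = fun t => -(fun t => -φ t) t := by simp
  have h3 : pascalTransform (fun q => appell φ q t) w r i =
      ∑ j ∈ Finset.range r, ∑ l ∈ Finset.range r, (((j.choose i : ℝ) * appell φ (j - i) t) *
        ((l.choose j : ℝ) * appell (fun t => -φ t) (l - j) t)) * z (l + 1) := by
    refine Finset.sum_congr rfl fun j hj => ?_
    rw [hw j (Finset.mem_range.1 hj), pascalTransform, Finset.mul_sum]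
    exact Finset.sum_congr rfl fun l _ => by ring
  rw [h3, Finset.sum_comm]
  have h4 : ∀ l ∈ Finset.range r, ∑ j ∈ Finset.range r,
      (((j.choose i : ℝ) * appell φ (j - i) t) *
        ((l.choose j : ℝ) * appell (fun t => -φ t) (l - j) t)) * z (l + 1) =
      (if l = i then 1 else 0) * z (l + 1) := by
    intro l hl
    have hl' := Finset.mem_range.1 hl
    rw [← Finset.sum_mul]
    congr 1
    have := sum_choose_mul_choose_appell (φ := fun t => -φ t) (r := r) (l := l) (i := i) (M := r)
      h₂ (by simpa using h₁) hl'.le hl' ht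
    simpa using this
  rw [Finset.sum_congr rfl h4]
  simp [hi]

lemma sum_choose_appell_mul_shiftedCoeff
    (h₁ : ∀ q < r, DifferentiableOn ℝ (appell φ q) (Ici 0))
    (h₂ : ∀ q < r, DifferentiableOn ℝ (appell (fun t => -φ t) q) (Ici 0)) (a : Fin r → ℝ) {t : ℝ}
    (ht : 0 ≤ t) (i : Fin r) :
    ∑ j ∈ Finset.range (r + 1), (j.choose i : ℝ) * appell (fun t => -φ t) (j - i) t *
      shiftedCoeff a φ j t = a i := by
  simp only [shiftedCoeff, Finset.mul_sum]
  rw [Finset.sum_comm]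
  have h4 : ∀ l ∈ Finset.range (r + 1), ∑ j ∈ Finset.range (r + 1),
      (j.choose i : ℝ) * appell (fun t => -φ t) (j - i) t *
        (monicCoeff a l * ((l.choose j : ℝ) * appell φ (l - j) t)) =
      monicCoeff a l * (if l = i then 1 else 0) := by
    intro l hl
    have hl' := Finset.mem_range.1 hl
    rw [← sum_choose_mul_choose_appell h₁ h₂ (show l ≤ r by omega) hl' ht, Finset.mul_sum]
    exact Finset.sum_congr rfl fun j _ => by ring
  rw [Finset.sum_congr rfl h4]
  have := i.2
  simp only [mul_ite, mul_one, mul_zero]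
  rw [Finset.sum_ite_eq' (Finset.range (r + 1)) (i : ℕ), if_pos (Finset.mem_range.2 (by omega))]
  simp [monicCoeff]

/-- Differentiating an entry of the transformation yields `-φ` times it minus the entry of the next
index. Together with the shift in `z`, re-indexed using `z 0 = 0`, the latter collapses by Pascal's
rule to row `i - 1`. The injected terms recombine to `a i`, because the Pascal matrix undoes the
passage from `a` to `shiftedCoeff`. -/
lemma hasDerivWithinAt_pascalTransform
    (h₁ : ∀ q < r, DifferentiableOn ℝ (appell φ q) (Ici 0))
    (h₂ : ∀ q < r, DifferentiableOn ℝ (appell (fun t => -φ t) q) (Ici 0)) (a : Fin r → ℝ)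
    {t₀ : ℝ} (ht₀ : 0 ≤ t₀) {z : ℕ → ℝ → ℝ} {t : ℝ} (ht : t₀ ≤ t) (hz0 : z 0 t = 0)
    (hz : ∀ j < r, HasDerivWithinAt (z (j + 1)) (z j t - shiftedCoeff a φ j t * z r t)
      (Ici t₀) t) (i : Fin r) :
    HasDerivWithinAt
      (fun t => pascalTransform (fun q => appell (fun t => -φ t) q t) (fun j => z j t) r i)
      ((if (i : ℕ) = 0 then 0 else
        pascalTransform (fun q => appell (fun t => -φ t) q t) (fun j => z j t) r (i - 1))
        - a i * z r t - φ t *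
          pascalTransform (fun q => appell (fun t => -φ t) q t) (fun j => z j t) r i)
      (Ici t₀) t := by
  have ht0 : 0 ≤ t := ht₀.trans ht
  have hd : HasDerivWithinAt
      (fun t => pascalTransform (fun q => appell (fun t => -φ t) q t) (fun j => z j t) r i)
      (∑ j ∈ Finset.range r, ((j.choose i : ℝ) * (-φ t * appell (fun t => -φ t) (j - i) t -
        appell (fun t => -φ t) (j - i + 1) t) * z (j + 1) t +
        (j.choose i : ℝ) * appell (fun t => -φ t) (j - i) t *
          (z j t - shiftedCoeff a φ j t * z r t))) (Ici t₀) t := by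
    refine HasDerivWithinAt.fun_sum fun j hj => ?_
    have hj' := Finset.mem_range.1 hj
    have d1 := (h₂ (j - i) (by omega) t ht0).hasDerivWithinAt.mono (Ici_subset_Ici.2 ht₀)
    refine ((d1.const_mul (j.choose i : ℝ)).mul (hz j hj')).congr_deriv ?_
    simp only [appell]
    ring
  refine hd.congr_deriv ?_
  set B : ℕ → ℝ := fun q => appell (fun t => -φ t) q t with hB
  have hinv := sum_choose_appell_mul_shiftedCoeff h₁ h₂ a ht0 i
  rw [Finset.sum_range_succ, shiftedCoeff_self, mul_one] at hinv
  have htel : ∑ j ∈ Finset.range r, (j.choose i : ℝ) * B (j - i) * z j t =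
      ∑ j ∈ Finset.range r, ((j + 1).choose i : ℝ) * B (j + 1 - i) * z (j + 1) t -
        (r.choose i : ℝ) * B (r - i) * z r t := by
    have h1 := Finset.sum_range_succ' (fun j => (j.choose i : ℝ) * B (j - i) * z j t) r
    rw [Finset.sum_range_succ, hz0, mul_zero, add_zero] at h1
    linarith
  have hpas : ∑ j ∈ Finset.range r, ((j + 1).choose i : ℝ) * B (j + 1 - i) * z (j + 1) t -
      ∑ j ∈ Finset.range r, (j.choose i : ℝ) * B (j - i + 1) * z (j + 1) t =
      if (i : ℕ) = 0 then 0 else pascalTransform B (fun j => z j t) r (i - 1) := by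
    rw [← Finset.sum_sub_distrib]
    by_cases hi : (i : ℕ) = 0
    · rw [if_pos hi, hi]
      exact Finset.sum_eq_zero fun j _ => by simp
    · rw [if_neg hi, pascalTransform]
      obtain ⟨l, hl⟩ := Nat.exists_eq_succ_of_ne_zero hi
      rw [hl]
      refine Finset.sum_congr rfl fun j _ => ?_
      rw [Nat.succ_eq_add_one, Nat.choose_succ_succ, Nat.succ_sub_succ, Nat.add_sub_cancel]
      rcases le_or_gt (l + 1) j with h | h
      · rw [show j - (l + 1) + 1 = j - l by omega]
        push_cast
        ring
      · rw [Nat.succ_eq_add_one, Nat.choose_eq_zero_of_lt h]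
        simp
  have hsplit : ∑ j ∈ Finset.range r, ((j.choose i : ℝ) * (-φ t * B (j - i) -
        B (j - i + 1)) * z (j + 1) t + (j.choose i : ℝ) * B (j - i) *
          (z j t - shiftedCoeff a φ j t * z r t)) =
      ∑ j ∈ Finset.range r, (j.choose i : ℝ) * B (j - i) * z j t -
      ∑ j ∈ Finset.range r, (j.choose i : ℝ) * B (j - i + 1) * z (j + 1) t -
      (∑ j ∈ Finset.range r, (j.choose i : ℝ) * B (j - i) * shiftedCoeff a φ j t) * z r t -
      φ t * pascalTransform B (fun j => z j t) r i := by
    rw [pascalTransform, Finset.mul_sum, Finset.sum_mul, ← Finset.sum_sub_distrib,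
      ← Finset.sum_sub_distrib, ← Finset.sum_sub_distrib]
    exact Finset.sum_congr rfl fun j _ => by ring
  change ∑ j ∈ Finset.range r, ((j.choose i : ℝ) * (-φ t * B (j - i) -
        B (j - i + 1)) * z (j + 1) t + (j.choose i : ℝ) * B (j - i) *
          (z j t - shiftedCoeff a φ j t * z r t)) = _
  rw [hsplit, htel, ← hpas, ← hinv]
  ring

end ShiftedState

/-! ### Uniform norm and quadratic form estimates -/

lemma exists_pascalTransform_bound (r : ℕ) {β : ℝ} (hβ : 0 ≤ β) :
    ∃ K ≥ 0, ∀ (b z : ℕ → ℝ) (Z : ℝ), (∀ q < r, |b q| ≤ β) → (∀ j < r, |z (j + 1)| ≤ Z) →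
      ∀ i < r, |pascalTransform b z r i| ≤ K * Z := by
  refine ⟨(∑ i ∈ Finset.range r, ∑ j ∈ Finset.range r, (j.choose i : ℝ)) * β, by positivity,
    fun b z Z hb hz i hi => ?_⟩
  have hZ : 0 ≤ Z := (abs_nonneg _).trans (hz i hi)
  calc |pascalTransform b z r i| ≤
        ∑ j ∈ Finset.range r, |(j.choose i : ℝ) * b (j - i) * z (j + 1)| :=
      Finset.abs_sum_le_sum_abs _ _
    _ ≤ ∑ j ∈ Finset.range r, (j.choose i : ℝ) * (β * Z) := by
      refine Finset.sum_le_sum fun j hj => ?_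
      have hj' := Finset.mem_range.1 hj
      rw [abs_mul, abs_mul, Nat.abs_cast, mul_assoc]
      have h1 := hb (j - i) (by omega)
      have h2 := hz j hj'
      gcongr
    _ = (∑ j ∈ Finset.range r, (j.choose i : ℝ)) * (β * Z) := (Finset.sum_mul _ _ _).symm
    _ ≤ (∑ i ∈ Finset.range r, ∑ j ∈ Finset.range r, (j.choose i : ℝ)) * (β * Z) := by
      refine mul_le_mul_of_nonneg_right ?_ (by positivity)
      exact Finset.single_le_sum (f := fun i => ∑ j ∈ Finset.range r, (j.choose i : ℝ))
        (fun i _ => by positivity) (Finset.mem_range.2 hi)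
    _ = _ := by ring

lemma dotProduct_self_le_card_mul_sq_norm {r : ℕ} (v : Fin r → ℝ) :
    v ⬝ᵥ v ≤ r * ‖v‖ ^ 2 := by
  calc v ⬝ᵥ v ≤ ∑ _i : Fin r, ‖v‖ ^ 2 := by
        refine Finset.sum_le_sum fun i _ => ?_
        rw [← abs_mul_abs_self, ← sq]
        have := norm_le_pi_norm v i
        rw [Real.norm_eq_abs] at this
        gcongr
    _ = _ := by simp

lemma sq_norm_le_dotProduct_self {r : ℕ} (v : Fin r → ℝ) : ‖v‖ ^ 2 ≤ v ⬝ᵥ v := by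
  have h0 : 0 ≤ v ⬝ᵥ v := Finset.sum_nonneg fun i _ => mul_self_nonneg _
  rw [← Real.le_sqrt (norm_nonneg _) h0, pi_norm_le_iff_of_nonneg (Real.sqrt_nonneg _)]
  intro i
  refine Real.le_sqrt_of_sq_le ?_
  rw [Real.norm_eq_abs, sq_abs, sq]
  exact Finset.single_le_sum (f := fun i => v i * v i) (fun i _ => mul_self_nonneg _)
    (Finset.mem_univ i)

/-- A strict bound of a quadratic form leaves a uniform margin. -/
lemma exists_uniform_margin {r : ℕ} (Q : Matrix (Fin r) (Fin r) ℝ) {lam : ℝ}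
    (h : ∀ v : Fin r → ℝ, v ≠ 0 → 2 * (v ⬝ᵥ (Q *ᵥ v)) < lam * (v ⬝ᵥ v)) :
    ∃ ε > 0, ∀ v : Fin r → ℝ, 2 * (v ⬝ᵥ (Q *ᵥ v)) ≤ (lam - ε) * (v ⬝ᵥ v) := by
  let f : (Fin r → ℝ) → ℝ := fun v => lam * (v ⬝ᵥ v) - 2 * (v ⬝ᵥ (Q *ᵥ v))
  have hf : Continuous f := by
    simp only [f, dotProduct, mulVec]
    fun_prop
  obtain ⟨c, hc, hcf⟩ := (isCompact_sphere (0 : Fin r → ℝ) 1).exists_forall_le' (a := 0)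
    hf.continuousOn fun v hv => by
      have hv0 : v ≠ 0 := by
        rintro rfl
        simp at hv
      exact sub_pos.2 (h v hv0)
  -- `c` is a positive lower bound of the form on the unit sphere of the sup norm, and `v ⬝ᵥ v ≤ r
  -- ‖v‖²` accounts for the change of norm.
  refine ⟨c / (r + 1), by positivity, fun v => ?_⟩
  by_cases hv : v = 0
  · simp [hv]
  have hn : 0 < ‖v‖ := norm_pos_iff.2 hv
  have h1 := hcf (‖v‖⁻¹ • v) (by simp [norm_smul, hn.ne'])
  have h2 : f v = ‖v‖ ^ 2 * f (‖v‖⁻¹ • v) := by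
    simp only [f, mulVec_smul, dotProduct_smul, smul_dotProduct, smul_eq_mul]
    field_simp
  have h3 : c * ‖v‖ ^ 2 ≤ f v := by
    rw [h2, mul_comm]
    gcongr
  have h4 := dotProduct_self_le_card_mul_sq_norm v
  have h5 : c / (r + 1) * (v ⬝ᵥ v) ≤ c * ‖v‖ ^ 2 := by
    rw [div_mul_eq_mul_div, div_le_iff₀ (by positivity)]
    nlinarith [sq_nonneg ‖v‖]
  simp only [f] at h3
  linarith

/-! ### Energy decay of the shifted system -/

section Energy

variable {g R : ℝ → ℝ} {k r : ℕ} {lam : ℝ}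

/-- Exponential decay of the shifted system `v̇ = (Qᵀ - φ) v`, `φ = g ^ k / (2 R)`, with the energy
`R ‖v‖²`. -/
lemma IsPersistenceFilter.exists_shifted_decay (hR : IsPersistenceFilter g k lam R)
    (Q : Matrix (Fin r) (Fin r) ℝ)
    (hQ : ∀ v : Fin r → ℝ, v ≠ 0 → 2 * (v ⬝ᵥ (Q *ᵥ v)) < lam * (v ⬝ᵥ v))
    {R₁ R₂ : ℝ} (hR₁ : 0 < R₁) (hRb : ∀ t ≥ 0, R₁ ≤ R t ∧ R t ≤ R₂) :
    ∃ K > 0, ∃ σ > 0, ∀ t₀ ≥ 0, ∀ v : ℝ → Fin r → ℝ,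
      (∀ t ≥ t₀, HasDerivWithinAt v (Qᵀ *ᵥ v t - (g t ^ k / (2 * R t)) • v t) (Ici t₀) t) →
      ∀ t ≥ t₀, ‖v t‖ ≤ K * Real.exp (-σ * (t - t₀)) * ‖v t₀‖ := by
  obtain ⟨ε, hε, hQε⟩ := exists_uniform_margin Q hQ
  have hR₂ : 0 < R₂ := hR₁.trans_le ((hRb 0 le_rfl).1.trans (hRb 0 le_rfl).2)
  refine ⟨R₂ * r / R₁ + 1, by positivity, ε / 2, by positivity, fun t₀ ht₀ v hv t ht => ?_⟩
  -- In the derivative, `g ^ k` from the filter cancels against `2 R φ` from the shift; the margin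
  -- `ε` pays for the exponential weight.
  set V : ℝ → ℝ := fun t => Real.exp (ε * (t - t₀)) * (R t * (v t ⬝ᵥ v t)) with hV
  have hder : ∀ t ≥ t₀, HasDerivWithinAt V (Real.exp (ε * (t - t₀)) *
      (R t * (2 * (v t ⬝ᵥ (Q *ᵥ v t)) - (lam - ε) * (v t ⬝ᵥ v t)))) (Ici t₀) t := by
    intro t ht
    have ht0 : 0 ≤ t := ht₀.le.trans ht
    have hRt : R t ≠ 0 := (hR₁.trans_le (hRb t ht0).1).ne'
    have h1 : HasDerivWithinAt (fun t => Real.exp (ε * (t - t₀)))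
        (Real.exp (ε * (t - t₀)) * (ε * 1)) (Ici t₀) t :=
      (((hasDerivWithinAt_id t (Ici t₀)).sub_const t₀).const_mul ε).exp
    have h2 := (hR.2 t ht0).mono (Ici_subset_Ici.2 ht₀)
    have h3 : HasDerivWithinAt (fun t => v t ⬝ᵥ v t)
        (2 * ((Qᵀ *ᵥ v t - (g t ^ k / (2 * R t)) • v t) ⬝ᵥ v t)) (Ici t₀) t := by
      have h4 : HasDerivWithinAt (fun t => ∑ i, v t i * v t i) _ (Ici t₀) t :=
        HasDerivWithinAt.fun_sum (u := Finset.univ) fun i _ =>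
          (hasDerivWithinAt_pi.1 (hv t ht) i).mul (hasDerivWithinAt_pi.1 (hv t ht) i)
      refine h4.congr_deriv ?_
      rw [dotProduct, Finset.mul_sum]
      exact Finset.sum_congr rfl fun i _ => by ring
    refine (h1.mul (h2.fun_mul h3)).congr_deriv ?_
    rw [sub_dotProduct, smul_dotProduct, mulVec_transpose, ← dotProduct_mulVec, smul_eq_mul]
    field_simp
    ring
  have hanti : AntitoneOn V (Ici t₀) := by
    refine antitoneOn_of_hasDerivWithinAt_nonpos (convex_Ici t₀)
      (fun t ht => (hder t ht).continuousWithinAt)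
      (fun t ht => (hder t (interior_subset ht)).mono interior_subset) fun t ht => ?_
    have ht0 : 0 ≤ t := ht₀.le.trans (interior_subset ht)
    refine mul_nonpos_of_nonneg_of_nonpos (Real.exp_nonneg _) (mul_nonpos_of_nonneg_of_nonpos
      (hR₁.trans_le (hRb t ht0).1).le ?_)
    linarith [hQε (v t)]
  have h1 := hanti (mem_Ici.2 le_rfl) ht ht
  have ht0 : 0 ≤ t := ht₀.le.trans ht
  simp only [hV, sub_self, mul_zero, Real.exp_zero, one_mul] at h1
  have h2 : R₁ * ‖v t‖ ^ 2 ≤ R t * (v t ⬝ᵥ v t) :=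
    mul_le_mul (hRb t ht0).1 (sq_norm_le_dotProduct_self _) (sq_nonneg _)
      (hR₁.trans_le (hRb t ht0).1).le
  have h3 : R t₀ * (v t₀ ⬝ᵥ v t₀) ≤ R₂ * (r * ‖v t₀‖ ^ 2) :=
    mul_le_mul (hRb t₀ ht₀).2 (dotProduct_self_le_card_mul_sq_norm _)
      ((sq_nonneg _).trans (sq_norm_le_dotProduct_self _)) hR₂.le
  have h4 : Real.exp (ε * (t - t₀)) * (R₁ * ‖v t‖ ^ 2) ≤ R₂ * (r * ‖v t₀‖ ^ 2) :=
    (mul_le_mul_of_nonneg_left h2 (Real.exp_nonneg _)).trans (h1.trans h3)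
  set K := R₂ * r / R₁ + 1 with hK
  -- Since `K ≤ K ^ 2`, no square root of the constant is needed when passing from squared norms to
  -- norms.
  have hK1 : 1 ≤ K := by
    have : 0 ≤ R₂ * r / R₁ := by positivity
    linarith
  have h5 : Real.exp (ε * (t - t₀)) * ‖v t‖ ^ 2 ≤ K * ‖v t₀‖ ^ 2 := by
    have h6 : Real.exp (ε * (t - t₀)) * ‖v t‖ ^ 2 ≤ R₂ * r / R₁ * ‖v t₀‖ ^ 2 := by
      rw [div_mul_eq_mul_div, le_div_iff₀ hR₁]
      linarith
    nlinarith [sq_nonneg ‖v t₀‖]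
  have h7 : ‖v t‖ ^ 2 ≤ (K * Real.exp (-(ε / 2) * (t - t₀)) * ‖v t₀‖) ^ 2 := by
    have h8 : Real.exp (-(ε / 2) * (t - t₀)) ^ 2 * Real.exp (ε * (t - t₀)) = 1 := by
      rw [← Real.exp_nat_mul, ← Real.exp_add, Real.exp_eq_one_iff]
      push_cast
      ring
    calc ‖v t‖ ^ 2 = Real.exp (-(ε / 2) * (t - t₀)) ^ 2 *
          (Real.exp (ε * (t - t₀)) * ‖v t‖ ^ 2) := by rw [← mul_assoc, h8, one_mul]
      _ ≤ Real.exp (-(ε / 2) * (t - t₀)) ^ 2 * (K * ‖v t₀‖ ^ 2) := by gcongr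
      _ ≤ Real.exp (-(ε / 2) * (t - t₀)) ^ 2 * (K ^ 2 * ‖v t₀‖ ^ 2) := by
        gcongr
        exact le_self_pow₀ hK1 two_ne_zero
      _ = _ := by ring
  exact le_of_sq_le_sq h7 (by positivity)

end Energy

/-! ### The persistence filter design -/

section Design

variable {g R : ℝ → ℝ} {k r N : ℕ} {lam : ℝ}

lemma exists_uniform_bound {r : ℕ} {F : ℕ → ℝ → ℝ} (h : ∀ q < r, ∃ M, ∀ t ≥ 0, |F q t| ≤ M) :
    ∃ β ≥ 0, ∀ q < r, ∀ t ≥ 0, |F q t| ≤ β := by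
  choose! M hM using h
  refine ⟨∑ q ∈ Finset.range r, |M q|, by positivity, fun q hq t ht => ?_⟩
  exact ((hM q hq t ht).trans (le_abs_self _)).trans
    (Finset.single_le_sum (f := fun q => |M q|) (fun _ _ => abs_nonneg _) (Finset.mem_range.2 hq))

/-- The gain of the persistence filter design factors continuously and boundedly through the
output gain. -/
lemma exists_filterGain_factor (a : Fin r → ℝ) (hg : BddSmooth N g)
    (hρ : BddSmooth N fun t => 1 / (2 * R t)) (hrk : r ≤ k) (hrN : r ≤ N + 1) :
    ∃ ℓ : ℝ → Fin r → ℝ, (∀ t ≥ 0, ∀ m, ℓ t m * g t = filterGain a g k R t m) ∧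
      (∃ M : ℝ, ∀ t ≥ 0, ‖ℓ t‖ ≤ M) ∧ ContinuousOn ℓ (Ici 0) := by
  have hφ : (fun τ => g τ ^ k / (2 * R τ)) = fun τ => g τ ^ k * (1 / (2 * R τ)) := by
    funext τ
    rw [mul_one_div]
  have hβ : ∀ q, q < r → ∃ β, BddSmooth 0 β ∧
      ∀ t ≥ 0, appell (fun τ => g τ ^ k / (2 * R τ)) (q + 1) t = β t * g t := fun q hq => by
    rw [hφ]
    exact exists_appell_eq_mul hg hρ (by omega) (by omega)
  choose! β hβs hβe using hβ
  -- In the coefficient `m` of `P(D + φ)` the term `l = m` is `a m`, which the gain subtracts. The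
  -- others contain `appell` at a positive index, so `g` factors out explicitly, and zeros of `g` do
  -- no harm.
  let ℓ : ℝ → Fin r → ℝ := fun t m => ∑ l ∈ (Finset.range (r + 1)).filter fun l => (m : ℕ) < l,
    monicCoeff a l * (l.choose m : ℝ) * β (l - m - 1) t
  have hℓ : ∀ m, BddSmooth 0 fun t => ℓ t m := fun m => by
    refine BddSmooth.sum fun l hl => BddSmooth.const_mul (hβs _ ?_) _
    rw [Finset.mem_filter, Finset.mem_range] at hl
    omega
  refine ⟨ℓ, fun t ht m => ?_, ?_, continuousOn_pi.2 fun m => (hℓ m).continuousOn⟩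
  · have h1 := shiftedCoeff_eq_add_filterGain a g k R t m
    have h2 : shiftedCoeff a (fun τ => g τ ^ k / (2 * R τ)) m t = a m + ℓ t m * g t := by
      rw [shiftedCoeff, ← Finset.sum_filter_add_sum_filter_not _ (fun l => (m : ℕ) < l), add_comm]
      congr 1
      · have hm := m.2
        rw [Finset.sum_eq_single (m : ℕ)]
        · simp [monicCoeff, appell]
        · intro l hl hlm
          rw [Finset.mem_filter] at hl
          rw [Nat.choose_eq_zero_of_lt (by omega)]
          simp
        · intro hm'
          simp only [Finset.mem_filter, Finset.mem_range] at hm'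
          omega
      · rw [Finset.sum_mul]
        refine Finset.sum_congr rfl fun l hl => ?_
        rw [Finset.mem_filter, Finset.mem_range] at hl
        rw [show l - (m : ℕ) = l - m - 1 + 1 by omega, hβe _ (by omega) t ht]
        simp only [Nat.add_sub_cancel]
        ring
    linarith
  · choose M hM using fun m => (hℓ m).bdd
    refine ⟨∑ m, |M m|, fun t ht => (pi_norm_le_iff_of_nonneg (by positivity)).2 fun m => ?_⟩
    exact ((hM m t ht).trans (le_abs_self _)).trans
      (Finset.single_le_sum (f := fun m => |M m|) (fun _ _ => abs_nonneg _) (Finset.mem_univ m))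

/-- The persistence filter design solves the nominal observer problem of a block. -/
theorem IsPersistenceFilter.exists_innovationGain (a : Fin r → ℝ)
    (hR : IsPersistenceFilter g k lam R) (hg : BddSmooth N g) (hPE : IsPE g) (hr : 0 < r)
    (hk : Even k) (hk2 : 2 ≤ k) (hrk : r ≤ k) (hrN : r ≤ N + 1) (hlam : 0 < lam)
    (hQ : ∀ v : Fin r → ℝ, v ≠ 0 → 2 * (v ⬝ᵥ (companion a *ᵥ v)) < lam * (v ⬝ᵥ v)) :
    ∃ ℓ : ℝ → Fin r → ℝ, (∀ t ≥ 0, ∀ m, ℓ t m * g t = filterGain a g k R t m) ∧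
      (∃ M : ℝ, ∀ t ≥ 0, ‖ℓ t‖ ≤ M) ∧ IsInnovationGain a g ℓ := by
  obtain ⟨R₁, hR₁, R₂, hRb⟩ := hR.exists_bounds (hg.mono (Nat.zero_le _)) hPE hk hk2 hlam
  have hρ := hR.bddSmooth_inv hg hR₁ fun t ht => (hRb t ht).1
  obtain ⟨ℓ, hℓ, hℓb, hℓc⟩ := exists_filterGain_factor a hg hρ hrk hrN
  refine ⟨ℓ, hℓ, hℓb, hℓc, ?_⟩
  set φ : ℝ → ℝ := fun τ => g τ ^ k / (2 * R τ) with hφ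
  have hφ1 : φ = fun τ => g τ ^ k * (1 / (2 * R τ)) := by
    funext τ
    rw [hφ, mul_one_div]
  -- The inverse transformation belongs to `-φ`, which has the same form with `1 / (2 R)` negated,
  -- so the same estimates apply.
  have hφ2 : (fun τ => -φ τ) = fun τ => g τ ^ k * (-1 * (1 / (2 * R τ))) := by
    funext τ
    rw [hφ1]
    ring
  have hs₁ : ∀ q < r, BddSmooth 1 (appell φ q) := fun q hq => by
    rw [hφ1]
    exact bddSmooth_appell hg hρ (by omega) (by omega)
  have hs₂ : ∀ q < r, BddSmooth 1 (appell (fun t => -φ t) q) := fun q hq => by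
    rw [hφ2]
    exact bddSmooth_appell hg (hρ.const_mul (-1)) (by omega) (by omega)
  have h₁ := fun q hq => (hs₁ q hq).1
  have h₂ := fun q hq => (hs₂ q hq).1
  obtain ⟨β₁, hβ₁, hb₁⟩ := exists_uniform_bound fun q hq => (hs₁ q hq).bdd
  obtain ⟨β₂, hβ₂, hb₂⟩ := exists_uniform_bound fun q hq => (hs₂ q hq).bdd
  obtain ⟨K₁, hK₁, hKb₁⟩ := exists_pascalTransform_bound r hβ₁
  obtain ⟨K₂, hK₂, hKb₂⟩ := exists_pascalTransform_bound r hβ₂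
  obtain ⟨K, hK, σ, hσ, hdec⟩ := hR.exists_shifted_decay (companion a) hQ hR₁ hRb
  -- `K₂` bounds the passage from `z` to `v`, `K` is the decay constant of `v`, and `K₁` bounds the
  -- way back.
  refine ⟨K₁ * K * K₂ + 1, by positivity, σ, hσ, fun t₀ ht₀ z hz t ht => ?_⟩
  let ζ : ℕ → ℝ → ℝ := fun j t => shiftEntry (z t) j
  let v : ℝ → Fin r → ℝ := fun t i =>
    pascalTransform (fun q => appell (fun t => -φ t) q t) (fun j => ζ j t) r i
  have hζ : ∀ t ≥ t₀, ∀ j < r, HasDerivWithinAt (ζ (j + 1))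
      (ζ j t - shiftedCoeff a φ j t * ζ r t) (Ici t₀) t := by
    intro t ht j hj
    have h3 := hasDerivWithinAt_pi.1 (hz t ht) ⟨j, hj⟩
    have h4 : ζ (j + 1) = fun t => z t ⟨j, hj⟩ := by
      funext t
      exact shiftEntry_succ (z t) ⟨j, hj⟩
    rw [h4]
    refine h3.congr_deriv ?_
    beta_reduce
    rw [nominalError_mulVec, hℓ t (ht₀.le.trans ht),
      shiftedCoeff_eq_add_filterGain a g k R t ⟨j, hj⟩]
  have hvs : ∀ t, ∀ j < r, shiftEntry (v t) (j + 1) =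
      pascalTransform (fun q => appell (fun t => -φ t) q t) (fun j => ζ j t) r j :=
    fun t j hj => shiftEntry_succ (v t) ⟨j, hj⟩
  have hv : ∀ t ≥ t₀, HasDerivWithinAt v ((companion a)ᵀ *ᵥ v t - φ t • v t) (Ici t₀) t := by
    intro t ht
    refine hasDerivWithinAt_pi.2 fun i => ?_
    refine (hasDerivWithinAt_pascalTransform h₁ h₂ a ht₀ ht (shiftEntry_zero _)
      (hζ t ht) i).congr_deriv ?_
    rw [Pi.sub_apply, companion_transpose_mulVec, Pi.smul_apply, smul_eq_mul]
    have hi := i.2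
    have h3 : shiftEntry (v t) r = ζ r t := by
      obtain ⟨r', rfl⟩ := Nat.exists_eq_succ_of_ne_zero hr.ne'
      rw [hvs t r' (Nat.lt_succ_self _)]
      exact pascalTransform_last _ _ _ _
    have h4 : shiftEntry (v t) i = if (i : ℕ) = 0 then 0 else
        pascalTransform (fun q => appell (fun t => -φ t) q t) (fun j => ζ j t) r (i - 1) := by
      split_ifs with h0
      · rw [h0, shiftEntry_zero]
      · rw [← hvs t (i - 1) (by omega), Nat.sub_add_cancel (Nat.pos_of_ne_zero h0)]
    rw [h3, h4]
  have hd := hdec t₀ ht₀ v hv t ht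
  have hv0 : ‖v t₀‖ ≤ K₂ * ‖z t₀‖ := (pi_norm_le_iff_of_nonneg (by positivity)).2 fun i =>
    hKb₂ _ _ ‖z t₀‖ (fun q hq => hb₂ q hq t₀ ht₀)
      (fun j hj => by
        have h3 : ζ (j + 1) t₀ = z t₀ ⟨j, hj⟩ := shiftEntry_succ (z t₀) ⟨j, hj⟩
        rw [h3]
        exact norm_le_pi_norm (z t₀) ⟨j, hj⟩) i i.2
  have hzt : ‖z t‖ ≤ K₁ * ‖v t‖ := (pi_norm_le_iff_of_nonneg (by positivity)).2 fun i => by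
    have ht0 : 0 ≤ t := ht₀.le.trans ht
    have h3 : z t i = pascalTransform (fun q => appell φ q t) (shiftEntry (v t)) r i := by
      rw [pascalTransform_pascalTransform h₁ h₂ (fun j => ζ j t) _ ht0 (hvs t) i.2]
      exact (shiftEntry_succ (z t) i).symm
    rw [h3]
    exact hKb₁ _ _ ‖v t‖ (fun q hq => hb₁ q hq t ht0)
      (fun j hj => by
        rw [show shiftEntry (v t) (j + 1) = v t ⟨j, hj⟩ from shiftEntry_succ (v t) ⟨j, hj⟩]
        exact norm_le_pi_norm (v t) ⟨j, hj⟩) i i.2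
  calc ‖z t‖ ≤ K₁ * ‖v t‖ := hzt
    _ ≤ K₁ * (K * Real.exp (-σ * (t - t₀)) * (K₂ * ‖z t₀‖)) := by
      gcongr
      exact hd.trans (by gcongr)
    _ = K₁ * K * K₂ * (Real.exp (-σ * (t - t₀)) * ‖z t₀‖) := by ring
    _ ≤ (K₁ * K * K₂ + 1) * (Real.exp (-σ * (t - t₀)) * ‖z t₀‖) := by
      gcongr
      linarith
    _ = _ := by ring

end Design

/-! ### The main theorem -/

theorem lemma2 {n s : ℕ} (A : Matrix (Fin n) (Fin n) ℝ) (C : Matrix (Fin s) (Fin n) ℝ)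
    (g : Fin s → ℝ → ℝ) (hobs : IsObservablePair A C)
    (hsmooth : ∀ i, IsBoundedSmooth (n - 1) (g i)) (hPE : ∀ i, IsPE (g i)) :
    -- the canonical transformation exists
    (∃ (p : ℕ) (r : Fin p → ℕ) (a : ∀ j, Fin (r j) → ℝ) (π : Fin p → Fin s)
      (T : Matrix (Σ j, Fin (r j)) (Fin n) ℝ) (S : Matrix (Fin n) (Σ j, Fin (r j)) ℝ),
      IsCanonicalTransformation A C r a π T S) ∧
    -- and for each such transformation
    ∀ (p : ℕ) (r : Fin p → ℕ) (a : ∀ j, Fin (r j) → ℝ) (π : Fin p → Fin s)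
      (T : Matrix (Σ j, Fin (r j)) (Fin n) ℝ) (S : Matrix (Fin n) (Σ j, Fin (r j)) ℝ),
      IsCanonicalTransformation A C r a π T S →
      -- the persistence filter design solves the nominal problem of every block
      (∀ (j : Fin p) (k : ℕ), Even k → 2 ≤ k → r j ≤ k → ∀ lam : ℝ, 0 < lam →
        (∀ v : Fin (r j) → ℝ, v ≠ 0 → 2 * (v ⬝ᵥ (companion (a j) *ᵥ v)) < lam * (v ⬝ᵥ v)) →
        ∀ R : ℝ → ℝ, IsPersistenceFilter (g (π j)) k lam R →
        ∃ ℓ : ℝ → Fin (r j) → ℝ,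
          (∀ t ≥ 0, ∀ m, ℓ t m * g (π j) t = filterGain (a j) (g (π j)) k R t m) ∧
          (∃ M : ℝ, ∀ t ≥ 0, ‖ℓ t‖ ≤ M) ∧
          IsInnovationGain (a j) (g (π j)) ℓ) ∧
      -- and with any designs for the nominal blocks the observer converges exponentially
      (∀ ℓ : ∀ j, ℝ → Fin (r j) → ℝ,
        (∀ j, IsInnovationGain (a j) (g (π j)) (ℓ j)) →
        ∃ m > 0, ∃ σ > 0, ∀ (u : ℝ → Fin n → ℝ), ∀ t₀ ≥ 0, ∀ x xhat : ℝ → Fin n → ℝ,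
          SolvesFrom (fun t v => A *ᵥ v + u t) t₀ x →
          SolvesFrom (fun t v => A *ᵥ v + u t
            + Tᵀ *ᵥ innovation π ℓ t (measuredOutput C g t (x t)) (measuredOutput C g t v))
            t₀ xhat →
          ∀ t ≥ t₀, ‖x t - xhat t‖ ≤ m * Real.exp (-σ * (t - t₀)) * ‖x t₀ - xhat t₀‖) := by
  refine ⟨hobs.exists_canonicalTransformation, fun p r a π T S hT => ⟨?_, fun ℓ hℓ =>
    hT.observer_converges (fun i => (hsmooth i).bddSmooth.continuousOn) hℓ⟩⟩
  intro j k hk hk2 hrk lam hlam hQ R hR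
  -- An invertible `T` is square, so `r j ≤ n`, and the `n - 1` derivatives of `g` suffice for the
  -- `r j - 1` differentiations in the gain.
  have hcard : ∑ j, r j = n := by
    simpa using Matrix.square_of_invertible T S hT.mul_inv hT.inv_mul
  have hrn : r j ≤ n := hcard ▸ Finset.single_le_sum (fun _ _ => Nat.zero_le _) (Finset.mem_univ j)
  exact hR.exists_innovationGain (a j) (hsmooth (π j)).bddSmooth (hPE (π j)) (hT.pos j) hk hk2 hrk
    (by omega) hlam hQ
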